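/- **Setting.** A network is a finite set $V$ of $N$ nodes in a square $G$ of edge length $L$ in the Euclidean plane. With range $\rho>0$, one transmission of $v$ reaches its set of neighbours $H_v=\{w\ne v:\ |v-w|\le\rho\}$. If node $v$ transmits with rate $C_v$, the capacity of a cut $(S,V\setminus S)$ is $C(S)=\sum_{v\in\Delta S}C_v$, where $\Delta S=\{v\in S:\ H_v\not\subseteq S\}$. For a source $s$ put $C_{\min}(s)=\min_{t\neq s}\ \min_{S\ni s,\ t\notin S}C(S)$; this is the maximum broadcast rate with network coding. Fix a width $W>\rho$; border nodes are the nodes within distance $W$ of the edge of $G$. The IREN/IRON rate selection gives rate $M$ to the source and to all border nodes, and rate $1$ to every other node, where $M$ is specified below. The number of transmissions per broadcast packet is $E_{\rm cost}=\frac1{C_{\min}(s)}\sum_v C_v$; with $M_{\max}=\max_v|H_v|$, the relative cost is $E_{\rm rel\text{-}cost}=E_{\rm cost}\big/\frac{N}{M_{\max}}$. The fraction of innovative receptions is $$\iota=\frac{(N-1)\,C_{\min}(s)}{\sum_v C_v|H_v|}$$ (when broadcasting at rate $C_{\min}(s)$, each of the $N-1$ other nodes receives $C_{\min}(s)$ packets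 carrying new information per unit time, out of $\sum_v C_v|H_v|$ receptions in total). **(1) Lattices.** Let $1\le\rho<W$ be fixed, and $M=|R|-1$ with $R=\{z\in\mathbb Z^2:|z|\le\rho\}$. There are constants $K,L_0$, depending only on $\rho$ and $W$, such that for every integer $L\ge L_0$, every half-open square $G=[a,a+L)\times[b,b+L)$ with node set $\mathbb Z^2\cap G$ (so $N=L^2$), and every source $s$, $$|E_{\rm rel\text{-}cost}-1|\le \frac KL\qquad\text{and}\qquad |\iota-1|\le\frac KL .$$ **(2) Random unit disk graphs.** Let $0<\rho<W$ and $0<\theta<1$ be fixed. Let $L_i>0$ be reals with $L_i\to\infty$ and $N_i$ integers such that $M_i:=\pi\rho^2N_i/L_i^2=L_i^\theta$ for all $i$. Let the $i$-th network consist of $N_i$ independent uniform points of $[0,L_i)^2$, with any source $s_i$ that is a measurable function of the locations, and with $M=M_i$ in the rate selection. Then, as $i\to\infty$, $$E_{\rm rel\text{-}cost}\to1\quad\text{and}\quad \iota\to 1\qquad\text{in probability},$$ and $E_{\rm rel\text{-}cost}\to1$ in probability also if in $E_{\rm cost}$ the number $\sum_vC_v$ of transmissions per unit time is replaced by its expectation.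 So asymptotically nearly every transmission is innovative for the receivers. -/

import Mathlib

open MeasureTheory ProbabilityTheory Filter Topology

namespace NearOptimalBroadcast

/-- The Euclidean plane. -/
abbrev Plane : Type := EuclideanSpace ℝ (Fin 2)

/-! ### Broadcast in a hypergraph with given transmission rates

`H v` is the set of nodes reached by one transmission of `v`, and `C v` is the rate of `v`. -/

section Hypergraph

variable {V : Type*} [Fintype V]

open Classical in
/-- The set `ΔS` of the nodes of `S` that reach at least one node outside `S`. -/
noncomputable def cutFrontier (H : V → Finset V) (S : Finset V) : Finset V :=
  S.filter (fun v => ∃ w ∈ H v, w ∉ S)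

/-- The capacity `C(S) = ∑_{v ∈ ΔS} C_v` of the cut `(S, V \ S)`. -/
noncomputable def cutCapacity (H : V → Finset V) (C : V → ℝ) (S : Finset V) : ℝ :=
  ∑ v ∈ cutFrontier H S, C v

/-- `C_min(s,t)`, the least capacity of a cut `(S, V \ S)` with `s ∈ S` and `t ∉ S`. -/
noncomputable def minCutTo (H : V → Finset V) (C : V → ℝ) (s t : V) : ℝ :=
  ⨅ S : {S : Finset V // s ∈ S ∧ t ∉ S}, cutCapacity H C S.1

/-- `C_min(s)`, the least `C_min(s,t)` over all destinations `t ≠ s`: the maximum broadcast rate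
of the source `s`. -/
noncomputable def minCut (H : V → Finset V) (C : V → ℝ) (s : V) : ℝ :=
  ⨅ t : {t : V // t ≠ s}, minCutTo H C s t.1

/-- `M_max`, the maximum number of neighbours of a node. -/
def maxNeighbors (H : V → Finset V) : ℕ :=
  Finset.univ.sup (fun v => (H v).card)

/-- Total number of transmissions in the network per unit time. -/
def transmissionRate (C : V → ℝ) : ℝ := ∑ v, C v

/-- `E_bound = N / M_max`, the least conceivable number of transmissions per broadcast packet. -/
noncomputable def costBound (H : V → Finset V) : ℝ :=
  (Fintype.card V : ℝ) / (maxNeighbors H : ℝ)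

/-- The relative cost `E_cost / E_bound`, where `E_cost = τ / C_min(s)` is the number of
transmissions per broadcast packet when `τ` transmissions are made per unit time. -/
noncomputable def relCostOf (τ : ℝ) (H : V → Finset V) (C : V → ℝ) (s : V) : ℝ :=
  (τ / minCut H C s) / costBound H

/-- The relative cost of the network with the rates `C` and the source `s`. -/
noncomputable def relCost (H : V → Finset V) (C : V → ℝ) (s : V) : ℝ :=
  relCostOf (transmissionRate C) H C s

/-- The fraction of packet receptions that are innovative when the source broadcasts at its maximum
rate `C_min(s)`: per unit time each of the `N - 1` other nodes receives `C_min(s)` packets that bring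
it new information, and altogether there are `∑_v C_v |H_v|` receptions. -/
noncomputable def innovativeFraction (H : V → Finset V) (C : V → ℝ) (s : V) : ℝ :=
  (((Fintype.card V : ℝ) - 1) * minCut H C s) / ∑ v, C v * ((H v).card : ℝ)

end Hypergraph

/-! ### Unit disk networks in a square and the rate selection -/

/-- The square of edge length `L` with lower left corner `c`. -/
def square (c : Plane) (L : ℝ) : Set Plane :=
  {p | ∀ k, c k ≤ p k ∧ p k < c k + L}

/-- The part of the square within distance `W` of its edge. -/
def borderArea (c : Plane) (L W : ℝ) : Set Plane :=
  {p | p ∈ square c L ∧ ∃ k, p k < c k + W ∨ c k + L - W < p k}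

open Classical in
/-- The neighbours of `v` in the unit disk graph of range `ρ` on nodes located at `pos`. -/
noncomputable def diskNeighbors {V : Type*} [Fintype V] (ρ : ℝ) (pos : V → Plane) (v : V) :
    Finset V :=
  Finset.univ.filter (fun w => w ≠ v ∧ dist (pos v) (pos w) ≤ ρ)

open Classical in
/-- IREN/IRON: the source and the border nodes transmit with rate `M`, all others with rate `1`. -/
noncomputable def irenIron {V : Type*} (M : ℝ) (border : Set Plane) (pos : V → Plane) (s : V)
    (v : V) : ℝ :=
  if v = s ∨ pos v ∈ border then M else 1

/-! ### Lattice networks -/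

/-- A point of the integer lattice, as a point of the plane. -/
noncomputable def latticePoint (z : ℤ × ℤ) : Plane := !₂[(z.1 : ℝ), (z.2 : ℝ)]

/-- The nodes of a lattice network: the points of the integer lattice in the square. -/
def LatticeNode (c : Plane) (L : ℝ) : Type := {z : ℤ × ℤ // latticePoint z ∈ square c L}

/-- The location of a lattice node. -/
noncomputable def LatticeNode.pos {c : Plane} {L : ℝ} (v : LatticeNode c L) : Plane :=
  latticePoint v.1

theorem finite_lattice (c : Plane) (L : ℝ) :
    {z : ℤ × ℤ | latticePoint z ∈ square c L}.Finite := by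
  refine ((Set.finite_Icc ⌊c 0⌋ ⌈c 0 + L⌉).prod (Set.finite_Icc ⌊c 1⌋ ⌈c 1 + L⌉)).subset ?_
  intro z hz
  have h0 := hz 0
  have h1 := hz 1
  simp only [latticePoint, PiLp.toLp_apply, Matrix.cons_val_zero, Matrix.cons_val_one] at h0 h1
  refine ⟨⟨?_, ?_⟩, ⟨?_, ?_⟩⟩
  · exact Int.cast_le.mp ((Int.floor_le (c 0)).trans h0.1)
  · exact_mod_cast h0.2.le.trans (Int.le_ceil _)
  · exact Int.cast_le.mp ((Int.floor_le (c 1)).trans h1.1)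
  · exact_mod_cast h1.2.le.trans (Int.le_ceil _)

noncomputable instance (c : Plane) (L : ℝ) : Fintype (LatticeNode c L) :=
  (finite_lattice c L).fintype

/-- `R`, the lattice points within range `ρ` of the origin. -/
def latticeDisk (ρ : ℝ) : Set (ℤ × ℤ) := {z | (z.1 : ℝ) ^ 2 + (z.2 : ℝ) ^ 2 ≤ ρ ^ 2}

/-- `M = |R| - 1`. -/
noncomputable def latticeM (ρ : ℝ) : ℝ := ((latticeDisk ρ).ncard : ℝ) - 1

/-- The neighbourhoods of a lattice network of range `ρ`. -/
noncomputable def latticeH (ρ : ℝ) (c : Plane) (L : ℝ) :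
    LatticeNode c L → Finset (LatticeNode c L) :=
  diskNeighbors ρ LatticeNode.pos

/-- The IREN/IRON rates on a lattice network with source `s`. -/
noncomputable def latticeRate (ρ W : ℝ) (c : Plane) (L : ℝ) (s : LatticeNode c L) :
    LatticeNode c L → ℝ :=
  irenIron (latticeM ρ) (borderArea c L W) LatticeNode.pos s

/-! ### Random unit disk graphs -/

/-- The law of `N` independent points, each uniform on the square of edge length `L`. -/
noncomputable def uniformNodes (N : ℕ) (L : ℝ) : Measure (Fin N → Plane) :=
  Measure.pi (fun _ => ProbabilityTheory.cond (volume : Measure Plane) (square 0 L))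

/-- `M = π ρ² N / L²`, the expected number of neighbours. -/
noncomputable def diskM (ρ : ℝ) (N : ℕ) (L : ℝ) : ℝ := Real.pi * ρ ^ 2 * ((N : ℝ) / L ^ 2)

/-- The IREN/IRON rates on the random network with nodes located at `x` and source `s`. -/
noncomputable def diskRate (ρ W : ℝ) (N : ℕ) (L : ℝ) (x : Fin N → Plane) (s : Fin N) :
    Fin N → ℝ :=
  irenIron (diskM ρ N L) (borderArea 0 L W) x s

/-- The expected number of transmissions per unit time in a random network whose source is chosen
by `s` from the locations of the nodes. -/
noncomputable def expectedTransmissionRate (ρ W : ℝ) (N : ℕ) (L : ℝ)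
    (s : (Fin N → Plane) → Fin N) : ℝ :=
  ∫ x, transmissionRate (diskRate ρ W N L x (s x)) ∂(uniformNodes N L)

/-- The real-valued functions `f i` on the probability spaces `(Ω i, P i)` converge to the
constant `a` in probability. -/
def TendstoInProb {Ω : ℕ → Type*} [∀ i, MeasurableSpace (Ω i)] (P : ∀ i, Measure (Ω i))
    (f : ∀ i, Ω i → ℝ) (a : ℝ) : Prop :=
  ∀ ε : ℝ, 0 < ε → Tendsto (fun i => P i {ω | ε ≤ |f i ω - a|}) atTop (𝓝 0)

end NearOptimalBroadcast

/-!
The min-cut is compared with `M` from below only; everything else follows from counting.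

*Upper bound of the efficiency.* Isolating a destination `t` is a cut, of capacity `∑ C_v` over the
nodes `v` that reach `t`. Summed over all `t ≠ s` this gives `(N - 1) C_min ≤ ∑_v C_v |H_v|`
(`card_sub_one_mul_minCut_le`). Hence the innovative fraction is at most `1`, and the relative cost
is at least `1 - 1 / N`. In the other direction it is enough that `C_min` is at least about `M`,
that the maximum degree is at most about `M`, and that the total rate is at most about `N`
(`relCostOf_mem_Icc`, `innovativeFraction_mem_Icc`).

*The min-cut.* The square is divided into grid cells, each holding at least `n` nodes, and `R` is a
set of offsets such that nodes in cells which differ by an element of `R` are neighbours. Then every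
cut has capacity at least `min M ((|R| - 1) n)` (`min_le_cutCapacity_of_grid`). If the frontier of
the cut contains the source or a border node, a single node contributes `M`. Otherwise the border,
being connected (`border_connected`), lies on one side of the cut. The other side then keeps a
distance of more than `ρ` from the edge of the square, so no translate by `R` is truncated, and the
inequality `|A + R| ≥ |A| + |R| - 1` for finite sets of integer vectors provides `|R| - 1` cells
that lie in the frontier with all their nodes.

*Lattices.* The cells are unit squares with one node each, and `R` is the lattice disk of radius
`ρ`, so that `C_min ≥ M` and the maximum degree is at most `M`. The border holds `O(L)` nodes.

*Random networks.* The cells have a small fixed edge length `r`, up to rounding. A cell holds on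
average a constant multiple of `L ^ θ` nodes, so by Chernoff's bound its count deviates by a factor
`1 ± η` with probability at most `2 exp (-κ L ^ θ)`, and a union bound over the `O(L²)` cells
suffices (`measureReal_not_isRegular_le`). If no cell deviates, the lattice disks of radii
`ρ / r ∓ √2` bound the min-cut from below and the degrees from above, and both contain about
`π (ρ / r)²` points for small `r`, by comparison with the area
(`exists_forall_card_diskOffsets`). The border nodes carry a total rate of about
`(4 W / L) N M = 4 W N L ^ (θ - 1)`, which is negligible against `N`, in expectation and by Markov's
inequality with high probability.
-/

namespace NearOptimalBroadcast

/-! ### Cuts and the bounds of relative cost and innovative fraction -/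

section Cuts

variable {V : Type*} [Fintype V]

theorem minCut_le_cutCapacity (H : V → Finset V) (C : V → ℝ) {s t : V} {S : Finset V}
    (hs : s ∈ S) (ht : t ∉ S) : minCut H C s ≤ cutCapacity H C S := by
  have hts : t ≠ s := fun h => ht (h ▸ hs)
  calc minCut H C s ≤ minCutTo H C s t :=
        ciInf_le (Set.finite_range _).bddBelow (⟨t, hts⟩ : {t : V // t ≠ s})
    _ ≤ cutCapacity H C S :=
        ciInf_le (Set.finite_range _).bddBelow
          (⟨S, hs, ht⟩ : {S : Finset V // s ∈ S ∧ t ∉ S})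

theorem le_minCut {V : Type*} (H : V → Finset V) (C : V → ℝ) {s : V} {m : ℝ} (hne : ∃ t, t ≠ s)
    (h : ∀ S : Finset V, s ∈ S → (∃ t, t ∉ S) → m ≤ cutCapacity H C S) :
    m ≤ minCut H C s := by
  classical
  have : Nonempty {t : V // t ≠ s} := let ⟨t, ht⟩ := hne; ⟨⟨t, ht⟩⟩
  refine le_ciInf fun t => ?_
  have : Nonempty {S : Finset V // s ∈ S ∧ t.1 ∉ S} :=
    ⟨⟨{s}, by simp, by simpa using t.2⟩⟩
  exact le_ciInf fun S => h S.1 S.2.1 ⟨t.1, S.2.2⟩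

/-- Every node other than the source must receive at the rate `C_min(s)`. This is the bound of the
min-cut by the cuts that isolate a single destination, summed over all destinations. -/
theorem card_sub_one_mul_minCut_le (H : V → Finset V) {C : V → ℝ} (hC : ∀ v, 0 ≤ C v) (s : V) :
    ((Fintype.card V : ℝ) - 1) * minCut H C s ≤ ∑ v, C v * ((H v).card : ℝ) := by
  classical
  have hcut : ∀ t ∈ Finset.univ.erase s,
      minCut H C s ≤ ∑ v, if t ∈ H v then C v else 0 := by
    intro t ht
    have hts : t ≠ s := Finset.ne_of_mem_erase ht
    refine (minCut_le_cutCapacity H C (S := Finset.univ.erase t) (t := t)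
      (by simpa using hts.symm) (by simp)).trans ?_
    rw [cutCapacity, ← Finset.sum_filter]
    refine Finset.sum_le_sum_of_subset_of_nonneg ?_ fun v _ _ => hC v
    intro v hv
    simp only [cutFrontier, Finset.mem_filter, Finset.mem_erase, Finset.mem_univ, and_true,
      not_not] at hv
    obtain ⟨_, w, hw, rfl⟩ := hv
    simpa using hw
  have hcard : ((Fintype.card V : ℝ) - 1) = ((Finset.univ.erase s).card : ℝ) := by
    rw [Finset.card_erase_of_mem (Finset.mem_univ s), Finset.card_univ,
      Nat.cast_sub (Fintype.card_pos_iff.2 ⟨s⟩), Nat.cast_one]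
  rw [hcard, ← nsmul_eq_mul]
  refine (Finset.card_nsmul_le_sum _ _ _ hcut).trans ?_
  rw [Finset.sum_comm]
  refine Finset.sum_le_sum fun v _ => ?_
  rw [← Finset.sum_filter, Finset.sum_const, nsmul_eq_mul, mul_comm]
  refine mul_le_mul_of_nonneg_left ?_ (hC v)
  exact_mod_cast Finset.card_le_card fun t ht => (Finset.mem_filter.1 ht).2

theorem sum_mul_card_le (H : V → Finset V) {C : V → ℝ} (hC : ∀ v, 0 ≤ C v) :
    ∑ v, C v * ((H v).card : ℝ) ≤ transmissionRate C * maxNeighbors H := by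
  rw [transmissionRate, Finset.sum_mul]
  refine Finset.sum_le_sum fun v _ => mul_le_mul_of_nonneg_left ?_ (hC v)
  exact_mod_cast Finset.le_sup (f := fun v => (H v).card) (Finset.mem_univ v)

/-- A bound of the maximum degree and of the number `τ` of transmissions against the min-cut
controls the relative cost from both sides. -/
theorem relCostOf_mem_Icc {H : V → Finset V} {C : V → ℝ} {s : V} {τ q γ : ℝ}
    (hC : ∀ v, 0 ≤ C v) (hγ : 0 < γ) (hcut : 0 < minCut H C s)
    (hτ : transmissionRate C ≤ γ * τ)
    (hq : maxNeighbors H * τ ≤ q * (minCut H C s * Fintype.card V)) :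
    relCostOf τ H C s ∈ Set.Icc ((1 - 1 / (Fintype.card V : ℝ)) / γ) q := by
  have hN : (0 : ℝ) < Fintype.card V := by exact_mod_cast Fintype.card_pos_iff.2 ⟨s⟩
  have hform : relCostOf τ H C s
      = maxNeighbors H * τ / (minCut H C s * Fintype.card V) := by
    rw [relCostOf, costBound, div_div_eq_mul_div, div_mul_eq_mul_div, div_div, mul_comm τ]
  rw [hform]
  constructor
  · rw [le_div_iff₀ (by positivity), div_mul_eq_mul_div, div_le_iff₀ hγ]
    calc (1 - 1 / (Fintype.card V : ℝ)) * (minCut H C s * Fintype.card V)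
        = ((Fintype.card V : ℝ) - 1) * minCut H C s := by field_simp
      _ ≤ transmissionRate C * maxNeighbors H :=
          (card_sub_one_mul_minCut_le H hC s).trans (sum_mul_card_le H hC)
      _ ≤ (γ * τ) * maxNeighbors H := mul_le_mul_of_nonneg_right hτ (Nat.cast_nonneg _)
      _ = maxNeighbors H * τ * γ := by ring
  · rwa [div_le_iff₀ (by positivity)]

theorem innovativeFraction_mem_Icc {H : V → Finset V} {C : V → ℝ} {s : V} {q : ℝ}
    (hC : ∀ v, 0 ≤ C v) (hq0 : 0 < q) (hcut : 0 < minCut H C s) (hN : 2 ≤ Fintype.card V)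
    (hq : maxNeighbors H * transmissionRate C ≤ q * (minCut H C s * Fintype.card V)) :
    innovativeFraction H C s ∈ Set.Icc ((1 - 1 / (Fintype.card V : ℝ)) / q) 1 := by
  have hN' : (2 : ℝ) ≤ Fintype.card V := by exact_mod_cast hN
  have hle := card_sub_one_mul_minCut_le H hC s
  have hpos : 0 < ((Fintype.card V : ℝ) - 1) * minCut H C s :=
    mul_pos (by linarith) hcut
  have hden := hpos.trans_le hle
  rw [innovativeFraction]
  constructor
  · rw [le_div_iff₀ hden, div_mul_eq_mul_div, div_le_iff₀ hq0]
    have h1 : (0 : ℝ) ≤ 1 - 1 / (Fintype.card V : ℝ) := by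
      rw [sub_nonneg, div_le_one (by linarith)]; linarith
    calc (1 - 1 / (Fintype.card V : ℝ)) * ∑ v, C v * ((H v).card : ℝ)
        ≤ (1 - 1 / (Fintype.card V : ℝ)) * (q * (minCut H C s * Fintype.card V)) :=
          mul_le_mul_of_nonneg_left
            ((sum_mul_card_le H hC).trans (by rw [mul_comm]; exact hq)) h1
      _ = ((Fintype.card V : ℝ) - 1) * minCut H C s * q := by field_simp
  · exact (div_le_one hden).2 hle

end Cuts

/-! ### Cuts of a network that is divided into grid cells -/

section Grid

/-- The cells of the `k × k` grid. -/
noncomputable def gridCells (k : ℤ) : Finset (ℤ × ℤ) := Finset.Ico 0 k ×ˢ Finset.Ico 0 k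

theorem mem_gridCells {k : ℤ} {q : ℤ × ℤ} :
    q ∈ gridCells k ↔ (0 ≤ q.1 ∧ q.1 < k) ∧ (0 ≤ q.2 ∧ q.2 < k) := by
  simp [gridCells]

open scoped Pointwise in
/-- A discrete isoperimetric inequality, from the Cauchy-Davenport theorem in a torsion-free
group. -/
theorem card_sub_one_le_card_sdiff {A D R : Finset (ℤ × ℤ)} (hA : A.Nonempty) (hR : R.Nonempty)
    (h : ∀ a ∈ A, ∀ u ∈ R, a + u ∈ D) : R.card - 1 ≤ (D \ A).card := by
  have h1 : A.card + R.card - 1 ≤ (A + R).card :=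
    cauchy_davenport_of_isAddTorsionFree hA hR
  have h2 : (A + R).card ≤ D.card := Finset.card_le_card fun x hx => by
    obtain ⟨a, ha, u, hu, rfl⟩ := Finset.mem_add.1 hx
    exact h a ha u hu
  have h3 : D.card - A.card ≤ (D \ A).card := Finset.le_card_sdiff _ _
  have := hA.card_pos
  omega

variable {V : Type*} [Fintype V]

open Classical in
theorem mul_card_le_card_of_cells {cell : V → ℤ × ℤ} {n : ℝ} {D : Finset (ℤ × ℤ)} {F : Finset V}
    (hcount : ∀ q ∈ D, n ≤ ((Finset.univ.filter fun v => cell v = q).card : ℝ))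
    (hF : ∀ v, cell v ∈ D → v ∈ F) : D.card * n ≤ (F.card : ℝ) := by
  have h1 : (Finset.univ.filter fun v => cell v ∈ D).card
      = ∑ q ∈ D, (Finset.univ.filter fun v => cell v = q).card := by
    rw [Finset.card_eq_sum_card_fiberwise (f := cell) (t := D)
      (fun v hv => by simpa using hv)]
    refine Finset.sum_congr rfl fun q hq => ?_
    congr 1
    ext v
    simp only [Finset.mem_filter, Finset.mem_univ, true_and]
    exact ⟨fun h => h.2, fun h => ⟨h ▸ hq, h⟩⟩
  have h2 : (Finset.univ.filter fun v => cell v ∈ D).card ≤ F.card :=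
    Finset.card_le_card fun v hv => hF v (Finset.mem_filter.1 hv).2
  calc D.card * n = ∑ _q ∈ D, n := by rw [Finset.sum_const, nsmul_eq_mul]
    _ ≤ ∑ q ∈ D, ((Finset.univ.filter fun v => cell v = q).card : ℝ) := Finset.sum_le_sum hcount
    _ = ((Finset.univ.filter fun v => cell v ∈ D).card : ℝ) := by rw [h1]; push_cast; rfl
    _ ≤ F.card := by exact_mod_cast h2

open Classical in
/-- The min-cut bound on a grid of cells holding at least `n` nodes each, `R` being a set of cell
offsets at which nodes are neighbours. If the frontier of the cut contains neither the source nor a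
node of the border `B`, then `B` lies on one side of the cut, and the isoperimetric inequality,
applied to the cells that meet the other side or to an erosion of it, puts `|R| - 1` whole cells
into the frontier. -/
theorem min_le_cutCapacity_of_grid {H : V → Finset V} {C : V → ℝ} {B : Set V} {s : V} {k : ℤ}
    {cell : V → ℤ × ℤ} {R : Finset (ℤ × ℤ)} {n M : ℝ}
    (hn : 0 < n)
    (hcount : ∀ q ∈ gridCells k, n ≤ ((Finset.univ.filter fun v => cell v = q).card : ℝ))
    (h0 : (0 : ℤ × ℤ) ∈ R) (hneg : ∀ u ∈ R, -u ∈ R)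
    (hadj : ∀ v w, w ≠ v → cell w - cell v ∈ R → w ∈ H v)
    (hint : ∀ v ∉ B, ∀ u ∈ R, cell v + u ∈ gridCells k)
    (hconn : ∀ S : Finset V,
      (∀ v ∈ B, ∀ w ∈ B, cell w - cell v ∈ R → (v ∈ S ↔ w ∈ S)) →
      ∀ v ∈ B, ∀ w ∈ B, (v ∈ S ↔ w ∈ S))
    (hM : ∀ v, v = s ∨ v ∈ B → M ≤ C v) (hC : ∀ v, 1 ≤ C v)
    {S : Finset V} (hs : s ∈ S) (hS : ∃ t, t ∉ S) :
    min M ((R.card - 1 : ℝ) * n) ≤ cutCapacity H C S := by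
  have hfront : ∀ v, v ∈ cutFrontier H S ↔ v ∈ S ∧ ∃ w ∈ H v, w ∉ S := fun v => by
    simp [cutFrontier]
  have hR : R.Nonempty := ⟨0, h0⟩
  by_cases hF : ∃ v ∈ cutFrontier H S, v = s ∨ v ∈ B
  · obtain ⟨v, hv, hvs⟩ := hF
    refine (min_le_left _ _).trans ((hM v hvs).trans ?_)
    exact Finset.single_le_sum (f := C) (fun w _ => zero_le_one.trans (hC w)) hv
  push Not at hF
  have hcap : ((cutFrontier H S).card : ℝ) ≤ cutCapacity H C S := by
    rw [cutCapacity]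
    simpa using Finset.card_nsmul_le_sum (cutFrontier H S) C 1 fun v _ => hC v
  refine (min_le_right _ _).trans (le_trans ?_ hcap)
  have hcross : ∀ v w, v ∈ S → w ∉ S → cell w - cell v ∈ R → v ∈ cutFrontier H S :=
    fun v w hv hw h => (hfront v).2 ⟨hv, w, hadj v w (fun e => hw (e ▸ hv)) h, hw⟩
  -- It is enough to find `|R| - 1` cells of the grid that lie in the frontier.
  suffices hD : ∃ D ⊆ gridCells k, R.card - 1 ≤ D.card ∧ ∀ v, cell v ∈ D → v ∈ cutFrontier H S by
    obtain ⟨D, hDk, hcard, hDF⟩ := hD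
    refine le_trans ?_ (mul_card_le_card_of_cells (fun q hq => hcount q (hDk hq)) hDF)
    refine mul_le_mul_of_nonneg_right ?_ hn.le
    rw [sub_le_iff_le_add]
    exact_mod_cast (by omega : R.card ≤ D.card + 1)
  have hB := hconn S fun v hv w hw h => by
    constructor
    · intro hvS
      by_contra hwS
      exact (hF v (hcross v w hvS hwS h)).2 hv
    · intro hwS
      by_contra hvS
      refine (hF w (hcross w v hwS hvS ?_)).2 hw
      simpa using hneg _ h
  by_cases hBS : ∀ v ∈ B, v ∈ S
  -- Border in `S`: the cells within `R` of a cell of `A`, but not in `A`, lie in the frontier.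
  · obtain ⟨t, ht⟩ := hS
    set A : Finset (ℤ × ℤ) := (Finset.univ.filter fun v => v ∉ S).image cell with hAdef
    have hmemA : ∀ q, q ∈ A ↔ ∃ v, v ∉ S ∧ cell v = q := fun q => by simp [hAdef]
    set D : Finset (ℤ × ℤ) := (gridCells k).filter fun q => ∃ a ∈ A, q - a ∈ R with hDdef
    refine ⟨D \ A, fun q hq => (Finset.mem_filter.1 (Finset.mem_sdiff.1 hq).1).1,
      card_sub_one_le_card_sdiff ⟨cell t, (hmemA _).2 ⟨t, ht, rfl⟩⟩ hR ?_, ?_⟩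
    · intro a ha u hu
      obtain ⟨v, hv, rfl⟩ := (hmemA a).1 ha
      exact Finset.mem_filter.2 ⟨hint v (fun hvB => hv (hBS v hvB)) u hu, cell v, ha, by simpa⟩
    · intro v hv
      obtain ⟨hvD, hvA⟩ := Finset.mem_sdiff.1 hv
      obtain ⟨-, a, ha, hau⟩ := Finset.mem_filter.1 hvD
      obtain ⟨w, hw, rfl⟩ := (hmemA a).1 ha
      have hvS : v ∈ S := by
        by_contra h
        exact hvA ((hmemA _).2 ⟨v, h, rfl⟩)
      exact hcross v w hvS hw (by simpa using hneg _ hau)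
  -- Border outside `S`: of the cells `F` that hold no node outside `S`, those not in the erosion
  -- `E` of `F` by `R` lie in the frontier. As the source does not, `E` is not empty.
  · push Not at hBS
    obtain ⟨b, hbB, hbS⟩ := hBS
    have hSB : ∀ v ∈ S, v ∉ B := fun v hv hvB => hbS ((hB v hvB b hbB).1 hv)
    set F : Finset (ℤ × ℤ) := (gridCells k).filter fun q => ∀ v, cell v = q → v ∈ S with hFdef
    set E : Finset (ℤ × ℤ) := F.filter fun q => ∀ u ∈ R, q + u ∈ F with hEdef
    have hout : ∀ v ∈ S, cell v ∉ E → v ∈ cutFrontier H S := by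
      intro v hv hvE
      have : ∃ u ∈ R, cell v + u ∉ F := by
        by_contra! h
        exact hvE (Finset.mem_filter.2 ⟨by simpa using h 0 h0, h⟩)
      obtain ⟨u, hu, huF⟩ := this
      have : ∃ w, cell w = cell v + u ∧ w ∉ S := by
        by_contra! h
        exact huF (Finset.mem_filter.2 ⟨hint v (hSB v hv) u hu, h⟩)
      obtain ⟨w, hw, hwS⟩ := this
      exact hcross v w hv hwS (by rw [hw]; simpa)
    have hsE : cell s ∈ E := by
      by_contra h
      exact (hF s (hout s hs h)).1 rfl
    refine ⟨F \ E, fun q hq => (Finset.mem_filter.1 (Finset.mem_sdiff.1 hq).1).1,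
      card_sub_one_le_card_sdiff ⟨_, hsE⟩ hR fun a ha u hu => (Finset.mem_filter.1 ha).2 u hu, ?_⟩
    intro v hv
    obtain ⟨hvF, hvE⟩ := Finset.mem_sdiff.1 hv
    exact hout v ((Finset.mem_filter.1 hvF).2 v rfl) hvE

end Grid

/-! ### Connectivity of the border -/

section Border

variable {V : Type*} {cell : V → ℤ × ℤ} {B : Set V} {S : Finset V} {k : ℤ} {R : Finset (ℤ × ℤ)}

/-- A walk along a straight line of cells that consist of border nodes, starting at any border node,
stays on one side of the cut. -/
theorem exists_border_node_along {d : ℤ × ℤ} (hd : d ∈ R)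
    (hne : ∀ q ∈ gridCells k, ∃ v, cell v = q)
    (hS : ∀ v ∈ B, ∀ w ∈ B, cell w - cell v ∈ R → (v ∈ S ↔ w ∈ S))
    {v : V} (hv : v ∈ B) (n : ℕ)
    (hpath : ∀ i : ℕ, 1 ≤ i → i ≤ n → cell v + i • d ∈ gridCells k ∧
      ∀ w, cell w = cell v + i • d → w ∈ B) :
    ∃ w ∈ B, cell w = cell v + n • d ∧ (v ∈ S ↔ w ∈ S) := by
  induction n with
  | zero => exact ⟨v, hv, by simp, Iff.rfl⟩
  | succ n ih =>
    obtain ⟨w, hw, hwc, hiff⟩ := ih fun i h1 h2 => hpath i h1 (h2.trans n.le_succ)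
    obtain ⟨hq, hqB⟩ := hpath (n + 1) (by omega) le_rfl
    obtain ⟨x, hx⟩ := hne _ hq
    refine ⟨x, hqB x hx, hx, hiff.trans (hS w hw x (hqB x hx) ?_)⟩
    rw [hx, hwc, succ_nsmul]
    simpa using hd

/-- The border is connected: every border node is joined to the corner cell `(0, 0)` by a walk that
leaves straight for a side of the square and then runs along the sides. -/
theorem border_connected
    (hne : ∀ q ∈ gridCells k, ∃ v, cell v = q) (hgrid : ∀ v, cell v ∈ gridCells k)
    (h0 : (0 : ℤ × ℤ) ∈ R) (hr : ((1, 0) : ℤ × ℤ) ∈ R) (hl : ((-1, 0) : ℤ × ℤ) ∈ R)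
    (hu : ((0, 1) : ℤ × ℤ) ∈ R) (hd : ((0, -1) : ℤ × ℤ) ∈ R)
    (hedge : ∀ w, (cell w).1 = 0 ∨ (cell w).1 = k - 1 ∨ (cell w).2 = 0 ∨ (cell w).2 = k - 1 →
      w ∈ B)
    (hB : ∀ v ∈ B, (∀ w, (cell w).1 < (cell v).1 → w ∈ B) ∨
      (∀ w, (cell v).1 < (cell w).1 → w ∈ B) ∨ (∀ w, (cell w).2 < (cell v).2 → w ∈ B) ∨
      (∀ w, (cell v).2 < (cell w).2 → w ∈ B))
    (hS : ∀ v ∈ B, ∀ w ∈ B, cell w - cell v ∈ R → (v ∈ S ↔ w ∈ S)) :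
    ∀ v ∈ B, ∀ w ∈ B, (v ∈ S ↔ w ∈ S) := by
  have hbd : ∀ v, (0 ≤ (cell v).1 ∧ (cell v).1 < k) ∧ (0 ≤ (cell v).2 ∧ (cell v).2 < k) :=
    fun v => mem_gridCells.1 (hgrid v)
  -- The four moves, each as far as the side of the square.
  have left : ∀ v ∈ B, (∀ w, (cell w).1 < (cell v).1 → (cell w).2 = (cell v).2 → w ∈ B) →
      ∃ w ∈ B, (cell w).1 = 0 ∧ (cell w).2 = (cell v).2 ∧ (v ∈ S ↔ w ∈ S) := by
    intro v hv h
    have hv' := hbd v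
    obtain ⟨w, hw, hc, hiff⟩ := exists_border_node_along hl hne hS hv (cell v).1.toNat
      (fun i h1 h2 => ⟨mem_gridCells.2 (by simp; omega), fun w hw => h w
        (by simp [hw]; omega) (by simp [hw])⟩)
    exact ⟨w, hw, by simp [hc]; omega, by simp [hc], hiff⟩
  have down : ∀ v ∈ B, (∀ w, (cell w).2 < (cell v).2 → (cell w).1 = (cell v).1 → w ∈ B) →
      ∃ w ∈ B, (cell w).2 = 0 ∧ (cell w).1 = (cell v).1 ∧ (v ∈ S ↔ w ∈ S) := by
    intro v hv h
    have hv' := hbd v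
    obtain ⟨w, hw, hc, hiff⟩ := exists_border_node_along hd hne hS hv (cell v).2.toNat
      (fun i h1 h2 => ⟨mem_gridCells.2 (by simp; omega), fun w hw => h w
        (by simp [hw]; omega) (by simp [hw])⟩)
    exact ⟨w, hw, by simp [hc]; omega, by simp [hc], hiff⟩
  have right : ∀ v ∈ B, (∀ w, (cell v).1 < (cell w).1 → w ∈ B) →
      ∃ w ∈ B, (cell w).1 = k - 1 ∧ (v ∈ S ↔ w ∈ S) := by
    intro v hv h
    have hv' := hbd v
    obtain ⟨w, hw, hc, hiff⟩ := exists_border_node_along hr hne hS hv (k - 1 - (cell v).1).toNat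
      (fun i h1 h2 => ⟨mem_gridCells.2 (by simp; omega), fun w hw => h w (by simp [hw]; omega)⟩)
    exact ⟨w, hw, by simp [hc]; omega, hiff⟩
  have up : ∀ v ∈ B, (∀ w, (cell v).2 < (cell w).2 → w ∈ B) →
      ∃ w ∈ B, (cell w).2 = k - 1 ∧ (v ∈ S ↔ w ∈ S) := by
    intro v hv h
    have hv' := hbd v
    obtain ⟨w, hw, hc, hiff⟩ := exists_border_node_along hu hne hS hv (k - 1 - (cell v).2).toNat
      (fun i h1 h2 => ⟨mem_gridCells.2 (by simp; omega), fun w hw => h w (by simp [hw]; omega)⟩)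
    exact ⟨w, hw, by simp [hc]; omega, hiff⟩
  suffices key : ∃ P : Prop, ∀ v ∈ B, (v ∈ S ↔ P) by
    obtain ⟨P, hP⟩ := key
    exact fun v hv w hw => (hP v hv).trans (hP w hw).symm
  by_cases hV : ∃ v, v ∈ B
  swap
  · exact ⟨True, fun v hv => absurd ⟨v, hv⟩ hV⟩
  obtain ⟨v₀, -⟩ := hV
  have hk : 0 < k := by have := hbd v₀; omega
  obtain ⟨o, ho⟩ := hne (0, 0) (mem_gridCells.2 (by simpa using hk))
  have hoB : o ∈ B := hedge o (by simp [ho])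
  refine ⟨o ∈ S, ?_⟩
  have corner : ∀ v ∈ B, (cell v).1 = 0 → (cell v).2 = 0 → (v ∈ S ↔ o ∈ S) := by
    intro v hv h1 h2
    refine hS v hv o hoB ?_
    rwa [ho, show cell v = 0 from Prod.ext h1 h2, show ((0, 0) : ℤ × ℤ) - 0 = 0 from rfl]
  have firstColumn : ∀ v ∈ B, (cell v).1 = 0 → (v ∈ S ↔ o ∈ S) := by
    intro v hv h
    obtain ⟨w, hw, h2, h1, hiff⟩ := down v hv fun w _ hw => hedge w (Or.inl (hw.trans h))
    exact hiff.trans (corner w hw (h1.trans h) h2)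
  have firstRow : ∀ v ∈ B, (cell v).2 = 0 → (v ∈ S ↔ o ∈ S) := by
    intro v hv h
    obtain ⟨w, hw, h2, h1, hiff⟩ := left v hv fun w _ hw =>
      hedge w (Or.inr (Or.inr (Or.inl (hw.trans h))))
    exact hiff.trans (corner w hw h2 (h1.trans h))
  intro v hv
  rcases hB v hv with h | h | h | h
  · obtain ⟨w, hw, h1, -, hiff⟩ := left v hv fun w hw _ => h w hw
    exact hiff.trans (firstColumn w hw h1)
  · obtain ⟨w, hw, h1, hiff⟩ := right v hv h
    obtain ⟨x, hx, h2, -, hiff'⟩ := down w hw fun x _ hx => hedge x (Or.inr (Or.inl (hx.trans h1)))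
    exact (hiff.trans hiff').trans (firstRow x hx h2)
  · obtain ⟨w, hw, h1, -, hiff⟩ := down v hv fun w hw _ => h w hw
    exact hiff.trans (firstRow w hw h1)
  · obtain ⟨w, hw, h1, hiff⟩ := up v hv h
    obtain ⟨x, hx, h2, -, hiff'⟩ := left w hw fun x _ hx =>
      hedge x (Or.inr (Or.inr (Or.inr (hx.trans h1))))
    exact (hiff.trans hiff').trans (firstColumn x hx h2)

end Border

/-! ### Unit disk networks divided into cells -/

/-- The index of the cell of `p` in the subdivision of the plane into squares of edge length `r`,
one of which has its lower left corner at `c`. -/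
noncomputable def cellOf (c : Plane) (r : ℝ) (p : Plane) : ℤ × ℤ :=
  (⌊(p 0 - c 0) / r⌋, ⌊(p 1 - c 1) / r⌋)

theorem finite_latticeDisk (ρ : ℝ) : (latticeDisk ρ).Finite := by
  refine ((Set.finite_Icc (-⌈|ρ|⌉) ⌈|ρ|⌉).prod (Set.finite_Icc (-⌈|ρ|⌉) ⌈|ρ|⌉)).subset ?_
  intro z hz
  have hz' : (z.1 : ℝ) ^ 2 + (z.2 : ℝ) ^ 2 ≤ ρ ^ 2 := hz
  have h1 : |(z.1 : ℝ)| ≤ ⌈|ρ|⌉ :=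
    (sq_le_sq.1 (by nlinarith [sq_nonneg (z.2 : ℝ)])).trans (Int.le_ceil _)
  have h2 : |(z.2 : ℝ)| ≤ ⌈|ρ|⌉ :=
    (sq_le_sq.1 (by nlinarith [sq_nonneg (z.1 : ℝ)])).trans (Int.le_ceil _)
  rw [abs_le] at h1 h2
  exact ⟨⟨by exact_mod_cast h1.1, by exact_mod_cast h1.2⟩,
    ⟨by exact_mod_cast h2.1, by exact_mod_cast h2.2⟩⟩

/-- The lattice points of a disk, as a finite set. -/
noncomputable def diskOffsets (x : ℝ) : Finset (ℤ × ℤ) := (finite_latticeDisk x).toFinset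

theorem mem_diskOffsets {x : ℝ} {z : ℤ × ℤ} :
    z ∈ diskOffsets x ↔ (z.1 : ℝ) ^ 2 + (z.2 : ℝ) ^ 2 ≤ x ^ 2 := by
  simp [diskOffsets, latticeDisk]

theorem card_diskOffsets (x : ℝ) : (diskOffsets x).card = (latticeDisk x).ncard :=
  (Set.ncard_eq_toFinset_card _ (finite_latticeDisk x)).symm

theorem cellOf_mem_gridCells {c p : Plane} {r L : ℝ} {k : ℤ} (hr : 0 < r) (hL : L = k * r)
    (hp : p ∈ square c L) : cellOf c r p ∈ gridCells k := by
  rw [mem_gridCells]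
  have h0 := hp 0
  have h1 := hp 1
  refine ⟨⟨Int.floor_nonneg.2 (div_nonneg (by linarith) hr.le), Int.floor_lt.2 ?_⟩,
    ⟨Int.floor_nonneg.2 (div_nonneg (by linarith) hr.le), Int.floor_lt.2 ?_⟩⟩ <;>
  · rw [div_lt_iff₀ hr]; linarith

theorem lt_of_floor_div_lt {a b r : ℝ} (hr : 0 < r) (h : ⌊a / r⌋ < ⌊b / r⌋) : a < b := by
  by_contra! hab
  exact absurd (Int.floor_mono (div_le_div_of_nonneg_right hab hr.le)) (not_le.2 h)

theorem floor_add_mem_Ico {a r L W ρ : ℝ} {k u : ℤ} (hr : 0 < r) (hL : L = k * r) (hW : ρ < W)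
    (h1 : W ≤ a) (h2 : a ≤ L - W) (hu : |(u : ℝ)| * r ≤ ρ) :
    0 ≤ ⌊a / r⌋ + u ∧ ⌊a / r⌋ + u < k := by
  have hu1 : (u : ℝ) * r ≤ ρ := (mul_le_mul_of_nonneg_right (le_abs_self _) hr.le).trans hu
  have hu2 : -(u : ℝ) * r ≤ ρ := (mul_le_mul_of_nonneg_right (neg_le_abs _) hr.le).trans hu
  rw [← Int.floor_add_intCast, Int.floor_nonneg, Int.floor_lt, div_add' _ _ _ hr.ne']
  exact ⟨div_nonneg (by linarith) hr.le, by rw [div_lt_iff₀ hr]; linarith⟩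

/-- The min-cut bound for the IREN/IRON rates in a square that is divided into cells with at least
`n` nodes each. -/
theorem min_le_minCut_of_cells {V : Type*} [Fintype V] {pos : V → Plane} {c : Plane} {s : V}
    {ρ W L r y n M : ℝ} {k : ℤ} (hr : 0 < r) (hrW : r < W) (hρW : ρ < W) (hL : L = k * r)
    (hy : 1 ≤ y) (hyρ : y * r ≤ ρ) (hn : 0 < n) (hM : 1 ≤ M)
    (hpos : ∀ v, pos v ∈ square c L)
    (hcount : ∀ q ∈ gridCells k,
      n ≤ ((Finset.univ.filter fun v => cellOf c r (pos v) = q).card : ℝ))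
    (hadj : ∀ v w, cellOf c r (pos w) - cellOf c r (pos v) ∈ diskOffsets y →
      dist (pos v) (pos w) ≤ ρ)
    (hV : ∃ t, t ≠ s) :
    min M (((diskOffsets y).card - 1 : ℝ) * n) ≤
      minCut (diskNeighbors ρ pos) (irenIron M (borderArea c L W) pos s) s := by
  classical
  have hgrid : ∀ v, cellOf c r (pos v) ∈ gridCells k :=
    fun v => cellOf_mem_gridCells hr hL (hpos v)
  have hy2 : 1 ≤ y ^ 2 := one_le_pow₀ hy
  have hne : ∀ q ∈ gridCells k, ∃ v, cellOf c r (pos v) = q := by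
    intro q hq
    have : 0 < (Finset.univ.filter fun v => cellOf c r (pos v) = q).card := by
      exact_mod_cast hn.trans_le (hcount q hq)
    obtain ⟨v, hv⟩ := Finset.card_pos.1 this
    exact ⟨v, by simpa using hv⟩
  have hcoord : ∀ u ∈ diskOffsets y, |(u.1 : ℝ)| * r ≤ ρ ∧ |(u.2 : ℝ)| * r ≤ ρ := by
    intro u hu
    rw [mem_diskOffsets] at hu
    have hy0 : |y| = y := abs_of_nonneg (by linarith)
    constructor <;> refine le_trans (mul_le_mul_of_nonneg_right ?_ hr.le) hyρ
    · exact hy0 ▸ sq_le_sq.1 (by nlinarith [sq_nonneg (u.2 : ℝ)])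
    · exact hy0 ▸ sq_le_sq.1 (by nlinarith [sq_nonneg (u.1 : ℝ)])
  refine le_minCut _ _ hV fun S hs hS =>
    min_le_cutCapacity_of_grid (B := {v | pos v ∈ borderArea c L W})
      (cell := fun v => cellOf c r (pos v)) hn hcount ?_ ?_ ?_ ?_ ?_ ?_ ?_ hs hS
  · simp [mem_diskOffsets, sq_nonneg]
  · intro u hu
    simpa [mem_diskOffsets] using hu
  · intro v w hwv h
    simpa [diskNeighbors, hwv] using hadj v w h
  · intro v hv u hu
    have hb : ∀ i, W ≤ pos v i - c i ∧ pos v i - c i ≤ L - W := by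
      intro i
      simp only [borderArea, Set.mem_ofPred_eq, not_and, not_exists, not_or, not_lt] at hv
      have := hv (hpos v) i
      constructor <;> linarith [this.1, this.2]
    exact mem_gridCells.2
      ⟨floor_add_mem_Ico hr hL hρW (hb 0).1 (hb 0).2 (hcoord u hu).1,
        floor_add_mem_Ico hr hL hρW (hb 1).1 (hb 1).2 (hcoord u hu).2⟩
  · intro S hS
    refine border_connected (k := k) (R := diskOffsets y) hne hgrid ?_ ?_ ?_ ?_ ?_ ?_ ?_ hS
    · simp [mem_diskOffsets, sq_nonneg]
    · simpa [mem_diskOffsets] using hy2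
    · simpa [mem_diskOffsets] using hy2
    · simpa [mem_diskOffsets] using hy2
    · simpa [mem_diskOffsets] using hy2
    · have hlow : ∀ a : ℝ, ⌊a / r⌋ = 0 → a < W := by
        intro a ha
        have := Int.lt_floor_add_one (a / r)
        rw [ha, Int.cast_zero, zero_add, div_lt_one hr] at this
        linarith
      have hhigh : ∀ a : ℝ, ⌊a / r⌋ = k - 1 → L - W < a := by
        intro a ha
        have := Int.floor_le (a / r)
        rw [ha, le_div_iff₀ hr] at this
        push_cast at this
        rw [hL]
        linarith
      rintro w (h | h | h | h)
      · exact ⟨hpos w, 0, Or.inl (by linarith [hlow _ h])⟩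
      · exact ⟨hpos w, 0, Or.inr (by linarith [hhigh _ h])⟩
      · exact ⟨hpos w, 1, Or.inl (by linarith [hlow _ h])⟩
      · exact ⟨hpos w, 1, Or.inr (by linarith [hhigh _ h])⟩
    · rintro v ⟨-, i, hi⟩
      fin_cases i
      · rcases hi with hi | hi
        · exact Or.inl fun w hw => ⟨hpos w, 0, Or.inl (by
            have := lt_of_floor_div_lt hr hw; simp at hi; linarith)⟩
        · exact Or.inr (Or.inl fun w hw => ⟨hpos w, 0, Or.inr (by
            have := lt_of_floor_div_lt hr hw; simp at hi; linarith)⟩)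
      · rcases hi with hi | hi
        · exact Or.inr (Or.inr (Or.inl fun w hw => ⟨hpos w, 1, Or.inl (by
            have := lt_of_floor_div_lt hr hw; simp at hi; linarith)⟩))
        · exact Or.inr (Or.inr (Or.inr fun w hw => ⟨hpos w, 1, Or.inr (by
            have := lt_of_floor_div_lt hr hw; simp at hi; linarith)⟩))
  · rintro v hv
    have hv' : v = s ∨ pos v ∈ borderArea c L W := hv
    simp [irenIron, hv']
  · intro v
    unfold irenIron
    split_ifs <;> simp [hM]

/-- The IREN/IRON rates sum up to at most one per node, and `M` more for the source and for each
border node. -/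
theorem transmissionRate_irenIron_le {V : Type*} [Fintype V] {pos : V → Plane} {B : Set Plane}
    {s : V} {M : ℝ} (hM : 0 ≤ M) [DecidablePred fun v => pos v ∈ B] :
    transmissionRate (irenIron M B pos s) ≤
      Fintype.card V + M + M * ((Finset.univ.filter fun v => pos v ∈ B).card : ℝ) := by
  classical
  have h : ∀ v, irenIron M B pos s v ≤ 1 + (if v = s then M else 0)
      + M * (if pos v ∈ B then 1 else 0) := by
    intro v
    unfold irenIron
    by_cases h1 : v = s <;> by_cases h2 : pos v ∈ B <;> simp [h1, h2] <;>
      (try split_ifs) <;> linarith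
  calc transmissionRate (irenIron M B pos s)
      ≤ ∑ v, (1 + (if v = s then M else 0) + M * (if pos v ∈ B then 1 else 0)) :=
        Finset.sum_le_sum fun v _ => h v
    _ = _ := by
        rw [Finset.sum_add_distrib, Finset.sum_add_distrib, ← Finset.mul_sum]
        simp

theorem card_le_transmissionRate_irenIron {V : Type*} [Fintype V] {pos : V → Plane} {B : Set Plane}
    {s : V} {M : ℝ} (hM : 1 ≤ M) :
    (Fintype.card V : ℝ) ≤ transmissionRate (irenIron M B pos s) := by
  have : ∀ v, 1 ≤ irenIron M B pos s v := by
    intro v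
    unfold irenIron
    split_ifs <;> simp [hM]
  simpa [transmissionRate] using Finset.card_nsmul_le_sum Finset.univ _ 1 fun v _ => this v

theorem irenIron_nonneg {V : Type*} {pos : V → Plane} {B : Set Plane}
    {s : V} {M : ℝ} (hM : 0 ≤ M) (v : V) : 0 ≤ irenIron M B pos s v := by
  unfold irenIron
  split_ifs <;> simp [hM]

/-! ### Lattice networks -/

theorem latticePoint_zero (z : ℤ × ℤ) : latticePoint z 0 = z.1 := rfl

theorem latticePoint_one (z : ℤ × ℤ) : latticePoint z 1 = z.2 := rfl

theorem dist_latticePoint_le_iff {ρ : ℝ} (hρ : 0 ≤ ρ) (z z' : ℤ × ℤ) :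
    dist (latticePoint z) (latticePoint z') ≤ ρ ↔ z' - z ∈ diskOffsets ρ := by
  rw [mem_diskOffsets, EuclideanSpace.dist_eq, Real.sqrt_le_left hρ, Fin.sum_univ_two,
    Real.dist_eq, Real.dist_eq, sq_abs, sq_abs]
  simp only [latticePoint_zero, latticePoint_one, Prod.fst_sub, Prod.snd_sub]
  push_cast
  rw [sub_sq_comm (z.1 : ℝ), sub_sq_comm (z.2 : ℝ)]

theorem cellOf_latticePoint (c : Plane) (z : ℤ × ℤ) :
    cellOf c 1 (latticePoint z) = z + (⌊-c 0⌋, ⌊-c 1⌋) := by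
  simp [cellOf, latticePoint_zero, latticePoint_one, sub_eq_add_neg, Int.floor_intCast_add,
    Prod.ext_iff]

theorem latticeNode_injective_cellOf (c : Plane) (L : ℝ) :
    Function.Injective fun v : LatticeNode c L => cellOf c 1 v.pos := by
  intro v w h
  simp only [LatticeNode.pos, cellOf_latticePoint, add_left_inj] at h
  exact Subtype.ext h

theorem exists_latticeNode_cellOf_eq {c : Plane} {L : ℕ} {q : ℤ × ℤ} (hq : q ∈ gridCells L) :
    ∃ v : LatticeNode c L, cellOf c 1 v.pos = q := by
  have hcoord : ∀ (a : ℝ) (i : ℤ), 0 ≤ i → i < L →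
      a ≤ ((i - ⌊-a⌋ : ℤ) : ℝ) ∧ ((i - ⌊-a⌋ : ℤ) : ℝ) < a + L := by
    intro a i h0 hL
    have h0' : (0 : ℝ) ≤ i := by exact_mod_cast h0
    have hL' : (i : ℝ) + 1 ≤ L := by exact_mod_cast hL
    have := Int.floor_le (-a)
    have := Int.lt_floor_add_one (-a)
    push_cast
    constructor <;> linarith
  rw [mem_gridCells] at hq
  refine ⟨⟨q - (⌊-c 0⌋, ⌊-c 1⌋), fun i => ?_⟩, ?_⟩
  · fin_cases i
    · exact hcoord (c 0) q.1 hq.1.1 hq.1.2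
    · exact hcoord (c 1) q.2 hq.2.1 hq.2.2
  · simp [LatticeNode.pos, cellOf_latticePoint]

theorem one_le_latticeM {ρ : ℝ} (hρ : 1 ≤ ρ) : 1 ≤ latticeM ρ := by
  have h : ({(0, 0), (1, 0)} : Finset (ℤ × ℤ)) ⊆ diskOffsets ρ := by
    have : 1 ≤ ρ ^ 2 := one_le_pow₀ hρ
    intro z hz
    simp only [Finset.mem_insert, Finset.mem_singleton] at hz
    rcases hz with rfl | rfl
    · simp [mem_diskOffsets, sq_nonneg]
    · simpa [mem_diskOffsets] using this
  have h2 : 2 ≤ (diskOffsets ρ).card := (Finset.card_le_card h).trans' (by decide)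
  have h2' : (2 : ℝ) ≤ (diskOffsets ρ).card := by exact_mod_cast h2
  rw [latticeM, ← card_diskOffsets]
  linarith

theorem maxNeighbors_latticeH_le {ρ : ℝ} (hρ : 0 ≤ ρ) (c : Plane) (L : ℝ) :
    (maxNeighbors (latticeH ρ c L) : ℝ) ≤ latticeM ρ := by
  classical
  have h0 : (0 : ℤ × ℤ) ∈ diskOffsets ρ := by simp [mem_diskOffsets, sq_nonneg]
  have hdeg : ∀ v, (latticeH ρ c L v).card ≤ (diskOffsets ρ).card - 1 := by
    intro v
    rw [← Finset.card_erase_of_mem h0]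
    refine Finset.card_le_card_of_injOn (fun w => w.1 - v.1) ?_ ?_
    · intro w hw
      obtain ⟨hwv, hd⟩ : w ≠ v ∧ dist v.pos w.pos ≤ ρ := by
        simpa [latticeH, diskNeighbors] using hw
      simp only [Finset.coe_erase, Set.mem_sdiff, Set.mem_singleton_iff, sub_eq_zero]
      exact ⟨(dist_latticePoint_le_iff hρ _ _).1 hd, fun h => hwv (Subtype.ext h)⟩
    · intro w _ w' _ h
      exact Subtype.ext (sub_left_injective h)
  have h1 : maxNeighbors (latticeH ρ c L) ≤ (diskOffsets ρ).card - 1 :=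
    Finset.sup_le fun v _ => hdeg v
  have h2 : (maxNeighbors (latticeH ρ c L) : ℝ) ≤ ((diskOffsets ρ).card - 1 : ℕ) := by
    exact_mod_cast h1
  rwa [Nat.cast_pred (Finset.card_pos.2 ⟨_, h0⟩), card_diskOffsets] at h2

theorem sq_le_card_latticeNode (c : Plane) (L : ℕ) :
    (L : ℝ) ^ 2 ≤ Fintype.card (LatticeNode c L) := by
  classical
  have h : gridCells L ⊆ Finset.univ.image fun v : LatticeNode c L => cellOf c 1 v.pos := by
    intro q hq
    obtain ⟨v, hv⟩ := exists_latticeNode_cellOf_eq (c := c) hq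
    exact Finset.mem_image.2 ⟨v, Finset.mem_univ v, hv⟩
  have h2 := (Finset.card_le_card h).trans Finset.card_image_le
  simp only [gridCells, Finset.card_product, Int.card_Ico, sub_zero, Int.toNat_natCast,
    Finset.card_univ] at h2
  rw [sq]
  exact_mod_cast h2

open Classical in
theorem card_border_latticeNode_le (c : Plane) (L : ℕ) {W : ℝ} (hW : 0 ≤ W) :
    ((Finset.univ.filter fun v : LatticeNode c L => v.pos ∈ borderArea c L W).card : ℝ)
      ≤ 4 * (W + 2) * L := by
  set m : ℕ := ⌈W⌉₊ + 1 with hm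
  have hWm : W ≤ ((m : ℤ) : ℝ) - 1 := by
    have := Nat.le_ceil W
    push_cast [hm]
    linarith
  have hmW : (m : ℝ) ≤ W + 2 := by
    have := Nat.ceil_lt_add_one hW
    push_cast [hm]
    linarith
  set T : Finset (ℤ × ℤ) :=
    (Finset.Ico 0 (m : ℤ) ×ˢ Finset.Ico 0 (L : ℤ) ∪
      Finset.Ico ((L : ℤ) - m) L ×ˢ Finset.Ico 0 (L : ℤ)) ∪
    (Finset.Ico 0 (L : ℤ) ×ˢ Finset.Ico 0 (m : ℤ) ∪
      Finset.Ico 0 (L : ℤ) ×ˢ Finset.Ico ((L : ℤ) - m) L) with hT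
  have hlow : ∀ a : ℝ, a < W → ⌊a⌋ < m := by
    intro a ha
    rw [Int.floor_lt]
    linarith
  have hhigh : ∀ a : ℝ, (L : ℝ) - W < a → (L : ℤ) - m ≤ ⌊a⌋ := by
    intro a ha
    rw [Int.le_floor]
    push_cast at hWm ⊢
    linarith
  have hmaps : ∀ v : LatticeNode c L, v.pos ∈ borderArea c L W → cellOf c 1 v.pos ∈ T := by
    rintro v ⟨hsq, i, hi⟩
    have hg := mem_gridCells.1 (cellOf_mem_gridCells (k := L) one_pos (by simp) hsq)
    simp only [hT, Finset.mem_union, Finset.mem_product, Finset.mem_Ico]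
    fin_cases i
    · rcases hi with hi | hi
      · have := hlow (v.pos 0 - c 0) (by simp at hi; linarith)
        exact Or.inl (Or.inl ⟨⟨hg.1.1, by simpa [cellOf] using this⟩, hg.2⟩)
      · have := hhigh (v.pos 0 - c 0) (by simp at hi; linarith)
        exact Or.inl (Or.inr ⟨⟨by simpa [cellOf] using this, hg.1.2⟩, hg.2⟩)
    · rcases hi with hi | hi
      · have := hlow (v.pos 1 - c 1) (by simp at hi; linarith)
        exact Or.inr (Or.inl ⟨hg.1, ⟨hg.2.1, by simpa [cellOf] using this⟩⟩)
      · have := hhigh (v.pos 1 - c 1) (by simp at hi; linarith)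
        exact Or.inr (Or.inr ⟨hg.1, ⟨by simpa [cellOf] using this, hg.2.2⟩⟩)
  have hTcard : T.card ≤ 4 * m * L := by
    refine (Finset.card_union_le _ _).trans ?_
    refine (add_le_add (Finset.card_union_le _ _) (Finset.card_union_le _ _)).trans ?_
    simp only [Finset.card_product, Int.card_Ico, sub_zero, Int.toNat_natCast, sub_sub_cancel]
    exact le_of_eq (by ring)
  have hle : (Finset.univ.filter fun v : LatticeNode c L => v.pos ∈ borderArea c L W).card
      ≤ T.card :=
    Finset.card_le_card_of_injOn (fun v => cellOf c 1 v.pos)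
      (fun v hv => hmaps v (by simpa using hv)) (latticeNode_injective_cellOf c L).injOn
  calc ((Finset.univ.filter fun v : LatticeNode c L => v.pos ∈ borderArea c L W).card : ℝ)
      ≤ 4 * m * L := by exact_mod_cast hle.trans hTcard
    _ ≤ 4 * (W + 2) * L := by gcongr

theorem latticeM_le_minCut {ρ W : ℝ} (hρ : 1 ≤ ρ) (hW : ρ < W) {L : ℕ} (c : Plane)
    (s : LatticeNode c L) (hV : ∃ t, t ≠ s) :
    latticeM ρ ≤ minCut (latticeH ρ c L) (latticeRate ρ W c L s) s := by
  classical
  have h := min_le_minCut_of_cells (pos := LatticeNode.pos) (c := c) (s := s) (ρ := ρ) (W := W)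
    (L := L) (r := 1) (y := ρ) (n := 1) (M := latticeM ρ) (k := L) one_pos (by linarith) hW
    (by simp) hρ (by simp) one_pos (one_le_latticeM hρ) (fun v => v.2) ?_ ?_ hV
  · rwa [mul_one, card_diskOffsets, ← latticeM, min_self] at h
  · intro q hq
    obtain ⟨v, hv⟩ := exists_latticeNode_cellOf_eq (c := c) hq
    exact_mod_cast Finset.card_pos.2 ⟨v, by simpa using hv⟩
  · intro v w h
    rw [LatticeNode.pos, LatticeNode.pos, cellOf_latticePoint, cellOf_latticePoint,
      add_sub_add_right_eq_sub] at h
    exact (dist_latticePoint_le_iff (by linarith) _ _).2 h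

theorem lattice_asymptotics {ρ W : ℝ} (hρ : 1 ≤ ρ) (hW : ρ < W) :
    ∃ K : ℝ, ∃ L₀ : ℕ, ∀ L : ℕ, L₀ ≤ L → ∀ (c : Plane) (s : LatticeNode c L),
      |relCost (latticeH ρ c L) (latticeRate ρ W c L s) s - 1| ≤ K / L ∧
      |innovativeFraction (latticeH ρ c L) (latticeRate ρ W c L s) s - 1| ≤ K / L := by
  classical
  have hM := one_le_latticeM hρ
  set M := latticeM ρ with hMdef
  set K₀ : ℝ := M * (1 + 4 * (W + 2)) with hK₀
  have hK₀pos : 0 < K₀ := mul_pos (by linarith) (by linarith)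
  refine ⟨K₀ + 1, 2, fun L hL c s => ?_⟩
  have hL' : (2 : ℝ) ≤ L := by exact_mod_cast hL
  have hN := sq_le_card_latticeNode c L
  have hN2 : 2 ≤ Fintype.card (LatticeNode c L) := by
    exact_mod_cast (show (2 : ℝ) ≤ Fintype.card (LatticeNode c L) by nlinarith)
  have hV : ∃ t, t ≠ s := Fintype.exists_ne_of_one_lt_card hN2 s
  have hcut := latticeM_le_minCut hρ hW c s hV
  have hcut0 := (zero_lt_one.trans_le hM).trans_le hcut
  have hC : ∀ v, 0 ≤ latticeRate ρ W c L s v := irenIron_nonneg (by linarith)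
  set N : ℝ := (Fintype.card (LatticeNode c L) : ℝ) with hNdef
  have hNL : (L : ℝ) ≤ N := by nlinarith
  have hN1 : 1 / N ≤ 1 / L := one_div_le_one_div_of_le (by linarith) hNL
  have hτ : transmissionRate (latticeRate ρ W c L s) ≤ (1 + K₀ / L) * N := by
    calc transmissionRate (latticeRate ρ W c L s)
        ≤ N + M + M * ((Finset.univ.filter fun v : LatticeNode c L =>
            v.pos ∈ borderArea c L W).card : ℝ) := transmissionRate_irenIron_le (by linarith)
      _ ≤ N + M * L + M * (4 * (W + 2) * L) := by
          gcongr
          · nlinarith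
          · exact card_border_latticeNode_le c L (by linarith)
      _ = N + K₀ / L * L ^ 2 := by rw [hK₀]; field_simp; ring
      _ ≤ N + K₀ / L * N := by gcongr
      _ = (1 + K₀ / L) * N := by ring
  have hq : maxNeighbors (latticeH ρ c L) * transmissionRate (latticeRate ρ W c L s) ≤
      (1 + K₀ / L) * (minCut (latticeH ρ c L) (latticeRate ρ W c L s) s * N) := by
    calc maxNeighbors (latticeH ρ c L) * transmissionRate (latticeRate ρ W c L s)
        ≤ minCut (latticeH ρ c L) (latticeRate ρ W c L s) s * ((1 + K₀ / L) * N) :=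
          mul_le_mul ((maxNeighbors_latticeH_le (by linarith) c L).trans hcut) hτ
            (Finset.sum_nonneg fun v _ => hC v) hcut0.le
      _ = _ := by ring
  have hrel := relCostOf_mem_Icc hC one_pos hcut0 (one_mul _).ge hq
  have hinn := innovativeFraction_mem_Icc hC (by positivity) hcut0 hN2 hq
  rw [div_one] at hrel
  have hKL : 0 < K₀ / L := by positivity
  have hL1 : 0 < 1 / (L : ℝ) := by positivity
  rw [add_div]
  constructor
  · rw [relCost, abs_le]
    constructor <;> linarith [hrel.1, hrel.2]
  · have : 1 - (K₀ / L + 1 / L) ≤ (1 - 1 / N) / (1 + K₀ / L) := by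
      rw [le_div_iff₀ (by positivity)]
      nlinarith [mul_pos hKL hL1]
    rw [abs_le]
    constructor <;> linarith [hinn.1, hinn.2]

/-! ### Lattice points in large disks -/

open scoped Pointwise in
/-- The number of lattice points of a large disk is asymptotic to the area of the disk. -/
theorem tendsto_card_diskOffsets_div_sq :
    Tendsto (fun x : ℝ => ((diskOffsets x).card : ℝ) / x ^ 2) atTop (𝓝 Real.pi) := by
  set e : (Fin 2 → ℝ) → Plane := WithLp.toLp 2
  have hmp : MeasurePreserving e := PiLp.volume_preserving_toLp (Fin 2)
  set D : Set (Fin 2 → ℝ) := {p | p 0 ^ 2 + p 1 ^ 2 ≤ 1} with hD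
  have hDe : D = e ⁻¹' Metric.closedBall 0 1 := by
    ext p
    simp [hD, e, EuclideanSpace.norm_eq, Fin.sum_univ_two]
  have hconv : Convex ℝ D := by
    rw [hDe]
    exact (convex_closedBall (0 : Plane) 1).linear_preimage
      (WithLp.linearEquiv 2 ℝ (Fin 2 → ℝ)).symm.toLinearMap
  have hbdd : Bornology.IsBounded D := by
    refine (Metric.isBounded_closedBall (x := (0 : Fin 2 → ℝ)) (r := 1)).subset fun p hp => ?_
    have hp' : p 0 ^ 2 + p 1 ^ 2 ≤ 1 := hp
    rw [mem_closedBall_zero_iff, pi_norm_le_iff_of_nonneg zero_le_one]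
    intro i
    rw [Real.norm_eq_abs, ← sq_le_one_iff_abs_le_one]
    fin_cases i
    · exact (le_add_of_nonneg_right (sq_nonneg _)).trans hp'
    · exact (le_add_of_nonneg_left (sq_nonneg _)).trans hp'
  have hmeas : MeasurableSet D := by
    rw [hDe]
    exact hmp.measurable Metric.isClosed_closedBall.measurableSet
  have hvol : volume.real D = Real.pi := by
    rw [measureReal_def, hDe,
      hmp.measure_preimage Metric.isClosed_closedBall.measurableSet.nullMeasurableSet,
      EuclideanSpace.volume_closedBall_fin_two]
    simp [Real.pi_pos.le]
  have hmono : ∀ ⦃x y : ℝ⦄, 0 < x → x ≤ y → x • D ⊆ y • D := by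
    intro x y hx hxy p hp
    have hy := hx.trans_le hxy
    rw [Set.mem_smul_set_iff_inv_smul_mem₀ hx.ne'] at hp
    rw [Set.mem_smul_set_iff_inv_smul_mem₀ hy.ne']
    simp only [hD, Set.mem_ofPred_eq, Pi.smul_apply, smul_eq_mul, mul_pow, ← mul_add] at hp ⊢
    refine le_trans (mul_le_mul_of_nonneg_right ?_ (by positivity)) hp
    gcongr
  have hlim := tendsto_card_div_pow_atTop_volume' D hbdd hmeas (hconv.addHaar_frontier volume) hmono
  rw [hvol] at hlim
  refine hlim.congr' ?_
  filter_upwards [eventually_gt_atTop 0] with x hx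
  rw [Fintype.card_fin]
  congr 2
  rw [card_diskOffsets]
  have hinj : Function.Injective fun z : ℤ × ℤ => x⁻¹ • (![(z.1 : ℝ), (z.2 : ℝ)] : Fin 2 → ℝ) := by
    intro z w h
    have h' := smul_right_injective _ (inv_ne_zero hx.ne') h
    have h0 := congrFun h' 0
    have h1 := congrFun h' 1
    simp only [Matrix.cons_val_zero, Matrix.cons_val_one, Int.cast_inj] at h0 h1
    exact Prod.ext h0 h1
  rw [← Set.ncard_image_of_injective _ hinj, Nat.card_coe_set_eq]
  congr 1
  ext p
  have hmem : ∀ z : ℤ × ℤ,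
      x⁻¹ • (![(z.1 : ℝ), (z.2 : ℝ)] : Fin 2 → ℝ) ∈ D ↔ z ∈ latticeDisk x := by
    intro z
    simp only [hD, latticeDisk, Set.mem_ofPred_eq, Pi.smul_apply, smul_eq_mul, mul_pow, ← mul_add,
      Matrix.cons_val_zero, Matrix.cons_val_one, inv_pow]
    rw [inv_mul_le_iff₀ (by positivity), mul_one]
  rw [Set.mem_inter_iff, Set.mem_smul_set, Set.mem_image]
  constructor
  · rintro ⟨hp, q, hq, rfl⟩
    rw [SetLike.mem_coe, (Pi.basisFun ℝ (Fin 2)).mem_span_iff_repr_mem ℤ] at hq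
    obtain ⟨a, ha⟩ := hq 0
    obtain ⟨b, hb⟩ := hq 1
    have hqab : q = ![(a : ℝ), (b : ℝ)] := by
      funext i
      fin_cases i
      · exact ha.symm
      · exact hb.symm
    rw [hqab] at hp
    exact ⟨(a, b), (hmem (a, b)).1 hp, by rw [hqab]⟩
  · rintro ⟨z, hz, rfl⟩
    refine ⟨(hmem z).2 hz, _, ?_, rfl⟩
    rw [SetLike.mem_coe, (Pi.basisFun ℝ (Fin 2)).mem_span_iff_repr_mem ℤ]
    intro i
    fin_cases i
    · exact ⟨z.1, rfl⟩
    · exact ⟨z.2, rfl⟩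

/-- Shifts of the radius by a constant do not change the asymptotic number of lattice points. -/
theorem exists_forall_card_diskOffsets {η : ℝ} (hη : 0 < η) (a : ℝ) :
    ∃ X : ℝ, ∀ x, X ≤ x → (1 - η) * (Real.pi * x ^ 2) ≤ ((diskOffsets (x - a)).card : ℝ) - 1 ∧
      ((diskOffsets (x + a)).card : ℝ) ≤ (1 + η) * (Real.pi * x ^ 2) := by
  have hshift : ∀ b : ℝ, Tendsto (fun x : ℝ => ((diskOffsets (x + b)).card : ℝ) / x ^ 2) atTop
      (𝓝 Real.pi) := by
    intro b
    have h1 : Tendsto (fun x : ℝ => ((x + b) / x) ^ 2) atTop (𝓝 1) := by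
      have : Tendsto (fun x : ℝ => (1 + b / x) ^ 2) atTop (𝓝 ((1 + 0) ^ 2)) :=
        ((tendsto_const_nhds.div_atTop tendsto_id).const_add 1).pow 2
      rw [add_zero, one_pow] at this
      refine this.congr' ?_
      filter_upwards [eventually_gt_atTop 0] with x hx
      field_simp
    have h2 := (tendsto_card_diskOffsets_div_sq.comp (tendsto_atTop_add_const_right _ b
      tendsto_id)).mul h1
    rw [mul_one] at h2
    refine h2.congr' ?_
    filter_upwards [eventually_gt_atTop 0, eventually_gt_atTop (-b)] with x hx hxb
    have : x + b ≠ 0 := by linarith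
    simp only [Function.comp, id]
    field_simp
  have hlow : Tendsto (fun x : ℝ => (((diskOffsets (x + -a)).card : ℝ) - 1) / x ^ 2) atTop
      (𝓝 Real.pi) := by
    have h1 : Tendsto (fun x : ℝ => 1 / x ^ 2) atTop (𝓝 0) :=
      tendsto_const_nhds.div_atTop (tendsto_pow_atTop two_ne_zero)
    have := (hshift (-a)).sub h1
    rw [sub_zero] at this
    exact this.congr fun x => (sub_div _ _ _).symm
  have hπ := Real.pi_pos
  have h1 : (1 - η) * Real.pi < Real.pi := by nlinarith
  have h2 : Real.pi < (1 + η) * Real.pi := by nlinarith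
  obtain ⟨X, hX⟩ := eventually_atTop.1 ((hlow.eventually_const_lt h1).and
    (((hshift a).eventually_lt_const h2).and (eventually_gt_atTop 0)))
  refine ⟨X, fun x hx => ?_⟩
  obtain ⟨ha, hb, hx0⟩ := hX x hx
  rw [lt_div_iff₀ (by positivity)] at ha
  rw [div_lt_iff₀ (by positivity)] at hb
  exact ⟨by rw [sub_eq_add_neg x]; linarith, by linarith⟩


/-! ### Chernoff's bound for independent points -/

section Chernoff

variable {E : Type*} [MeasurableSpace E] {μ : Measure E} [IsProbabilityMeasure μ] {Q : Set E}

open Classical in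
theorem measurable_card_filter_mem (hQ : MeasurableSet Q) (N : ℕ) :
    Measurable fun x : Fin N → E => ((Finset.univ.filter fun v => x v ∈ Q).card : ℝ) := by
  have : (fun x : Fin N → E => ((Finset.univ.filter fun v => x v ∈ Q).card : ℝ))
      = fun x => ∑ v, if x v ∈ Q then (1 : ℝ) else 0 := by
    funext x
    simp
  rw [this]
  exact Finset.measurable_fun_sum _ fun v _ =>
    Measurable.ite (measurable_pi_apply v hQ) measurable_const measurable_const

open Classical in
/-- The exponential Markov inequality for the number of hits of `Q` among `N` independent
points. -/
theorem measureReal_le_exp_of_card_mem (hQ : MeasurableSet Q) (N : ℕ) (a t : ℝ) :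
    (Measure.pi fun _ : Fin N => μ).real
      {x | t ≤ a * ((Finset.univ.filter fun v => x v ∈ Q).card : ℝ)}
      ≤ Real.exp (N * μ.real Q * (Real.exp a - 1) - t) := by
  set f : E → ℝ := fun y => if y ∈ Q then Real.exp a else 1 with hf
  have hfint : ∫ y, f y ∂μ = 1 + μ.real Q * (Real.exp a - 1) := by
    have : f = fun y => 1 + Q.indicator (fun _ => Real.exp a - 1) y := by
      funext y
      by_cases hy : y ∈ Q <;> simp [hf, hy]
    rw [this, integral_add (integrable_const _) ((integrable_const _).indicator hQ),
      integral_indicator_const _ hQ]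
    simp
  have hprod : ∀ x : Fin N → E,
      Real.exp (a * ((Finset.univ.filter fun v => x v ∈ Q).card : ℝ)) = ∏ v, f (x v) := by
    intro x
    rw [hf, Finset.prod_ite]
    simp [mul_comm a, Real.exp_nat_mul]
  have hint : ∫ x, Real.exp (a * ((Finset.univ.filter fun v => x v ∈ Q).card : ℝ))
      ∂(Measure.pi fun _ : Fin N => μ) ≤ Real.exp (N * μ.real Q * (Real.exp a - 1)) := by
    simp_rw [hprod]
    rw [integral_fintype_prod_eq_pow f, hfint, Fintype.card_fin, mul_assoc, Real.exp_nat_mul]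
    refine pow_le_pow_left₀ ?_ ?_ N
    · have h1 : μ.real Q ≤ 1 := measureReal_le_one
      have h2 : 0 ≤ μ.real Q := measureReal_nonneg
      nlinarith [Real.exp_pos a]
    · linarith [Real.add_one_le_exp (μ.real Q * (Real.exp a - 1))]
  have hbdd : Integrable (fun x : Fin N → E =>
      Real.exp (a * ((Finset.univ.filter fun v => x v ∈ Q).card : ℝ)))
      (Measure.pi fun _ : Fin N => μ) := by
    refine Integrable.of_bound (C := Real.exp (|a| * N))
      ((measurable_card_filter_mem hQ N).const_mul a).exp.aestronglyMeasurable
      (ae_of_all _ fun x => ?_)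
    rw [Real.norm_eq_abs, Real.abs_exp, Real.exp_le_exp]
    refine mul_le_mul (le_abs_self a) ?_ (Nat.cast_nonneg _) (abs_nonneg a)
    exact_mod_cast (Finset.card_le_univ _).trans (Fintype.card_fin N).le
  have hmarkov := mul_meas_ge_le_integral_of_nonneg
    (ae_of_all _ fun x => (Real.exp_pos _).le) hbdd (Real.exp t)
  simp only [Real.exp_le_exp] at hmarkov
  rw [Real.exp_sub, le_div_iff₀ (Real.exp_pos t), mul_comm]
  exact hmarkov.trans hint

open Classical in
/-- Chernoff's bound for the number of hits of `Q` among `N` independent points. -/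
theorem measureReal_card_mem_deviates_le (hQ : MeasurableSet Q) (N : ℕ) {m η : ℝ}
    (hm : N * μ.real Q = m) (hη : 0 < η) (hη1 : η ≤ 1) :
    (Measure.pi fun _ : Fin N => μ).real
      {x | ¬ ((1 - η) * m ≤ ((Finset.univ.filter fun v => x v ∈ Q).card : ℝ) ∧
        ((Finset.univ.filter fun v => x v ∈ Q).card : ℝ) ≤ (1 + η) * m)}
      ≤ 2 * Real.exp (-(m * η ^ 2 / 4)) := by
  have hm0 : 0 ≤ m := hm ▸ mul_nonneg (Nat.cast_nonneg _) measureReal_nonneg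
  -- The exponent `a = ± η / 2` minimizes the quadratic bound of the exponential Markov inequality.
  have htail : ∀ a : ℝ, a ^ 2 = (η / 2) ^ 2 → (Measure.pi fun _ : Fin N => μ).real
      {x | a * m + η ^ 2 / 2 * m ≤ a * ((Finset.univ.filter fun v => x v ∈ Q).card : ℝ)}
      ≤ Real.exp (-(m * η ^ 2 / 4)) := by
    intro a ha
    refine (measureReal_le_exp_of_card_mem hQ N a _).trans (Real.exp_le_exp.2 ?_)
    have ha1 : |a| ≤ 1 := by
      rw [← sq_le_one_iff_abs_le_one, ha]
      nlinarith
    have hexp := (abs_le.1 (Real.abs_exp_sub_one_sub_id_le ha1)).2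
    rw [hm]
    nlinarith [mul_le_mul_of_nonneg_left hexp hm0]
  have hlow := htail (-(η / 2)) (by ring)
  have hhigh := htail (η / 2) rfl
  rw [two_mul]
  refine le_trans (le_trans (measureReal_mono ?_) (measureReal_union_le _ _))
    (add_le_add hlow hhigh)
  intro x hx
  rw [Set.mem_ofPred_eq, not_and_or, not_le, not_le] at hx
  rcases hx with hx | hx
  · exact Or.inl (by simp only [Set.mem_ofPred_eq]; nlinarith)
  · exact Or.inr (by simp only [Set.mem_ofPred_eq]; nlinarith)

end Chernoff

/-! ### Networks with nearly equally filled cells -/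

theorem norm_latticePoint_le_iff {y : ℝ} (hy : 0 ≤ y) (z : ℤ × ℤ) :
    ‖latticePoint z‖ ≤ y ↔ z ∈ diskOffsets y := by
  rw [mem_diskOffsets, EuclideanSpace.norm_eq, Real.sqrt_le_left hy, Fin.sum_univ_two,
    Real.norm_eq_abs, Real.norm_eq_abs, sq_abs, sq_abs, latticePoint_zero, latticePoint_one]

/-- Up to `√2`, in units of the edge length, the cells of two points determine their difference. -/
theorem norm_sub_latticePoint_cellOf_le (c : Plane) (r : ℝ) (p p' : Plane) :
    ‖r⁻¹ • (p' - p) - latticePoint (cellOf c r p' - cellOf c r p)‖ ≤ √2 := by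
  have hcoord : ∀ a a' b : ℝ,
      (r⁻¹ * (a' - a) - ((⌊(a' - b) / r⌋ - ⌊(a - b) / r⌋ : ℤ) : ℝ)) ^ 2 ≤ 1 := by
    intro a a' b
    have : r⁻¹ * (a' - a) - ((⌊(a' - b) / r⌋ - ⌊(a - b) / r⌋ : ℤ) : ℝ)
        = Int.fract ((a' - b) / r) - Int.fract ((a - b) / r) := by
      simp only [Int.fract]
      push_cast
      ring
    rw [this, sq_le_one_iff_abs_le_one, abs_le]
    have := Int.fract_nonneg ((a' - b) / r)
    have := Int.fract_lt_one ((a' - b) / r)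
    have := Int.fract_nonneg ((a - b) / r)
    have := Int.fract_lt_one ((a - b) / r)
    constructor <;> linarith
  rw [EuclideanSpace.norm_eq]
  refine Real.sqrt_le_sqrt ?_
  rw [Fin.sum_univ_two, Real.norm_eq_abs, Real.norm_eq_abs, sq_abs, sq_abs]
  have h0 := hcoord (p 0) (p' 0) (c 0)
  have h1 := hcoord (p 1) (p' 1) (c 1)
  simp only [PiLp.sub_apply, PiLp.smul_apply, smul_eq_mul, latticePoint_zero, latticePoint_one,
    cellOf, Prod.fst_sub, Prod.snd_sub]
  linarith

theorem dist_eq_mul_norm {r : ℝ} (hr : 0 < r) (p p' : Plane) :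
    dist p p' = r * ‖r⁻¹ • (p' - p)‖ := by
  rw [norm_smul, Real.norm_eq_abs, abs_of_pos (inv_pos.2 hr), mul_inv_cancel_left₀ hr.ne',
    dist_comm, dist_eq_norm]

theorem dist_le_of_cellOf_sub_mem {c : Plane} {r ρ : ℝ} {p p' : Plane} (hr : 0 < r)
    (hy : 0 ≤ ρ / r - √2) (h : cellOf c r p' - cellOf c r p ∈ diskOffsets (ρ / r - √2)) :
    dist p p' ≤ ρ := by
  rw [← norm_latticePoint_le_iff hy] at h
  have h1 := norm_sub_latticePoint_cellOf_le c r p p'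
  have h2 := norm_sub_norm_le (r⁻¹ • (p' - p)) (latticePoint (cellOf c r p' - cellOf c r p))
  rw [dist_eq_mul_norm hr, ← le_div_iff₀' hr]
  linarith

theorem cellOf_sub_mem_of_dist_le {c : Plane} {r ρ : ℝ} {p p' : Plane} (hr : 0 < r)
    (hρ : 0 ≤ ρ) (h : dist p p' ≤ ρ) :
    cellOf c r p' - cellOf c r p ∈ diskOffsets (ρ / r + √2) := by
  rw [← norm_latticePoint_le_iff (by positivity)]
  have h1 := norm_sub_latticePoint_cellOf_le c r p p'
  have h2 := norm_sub_norm_le (latticePoint (cellOf c r p' - cellOf c r p)) (r⁻¹ • (p' - p))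
  rw [dist_eq_mul_norm hr, ← le_div_iff₀' hr] at h
  rw [norm_sub_rev] at h2
  linarith

open Classical in
/-- The locations `x` are regular at the resolution `r` up to the relative error `η`: all nodes lie
in the square of edge length `k r`, each of its `k²` cells holds about the same number of nodes, and
the rates `M` of the border nodes sum up to at most `η` per node of the network. -/
def IsRegular (W M r η : ℝ) (k N : ℕ) (x : Fin N → Plane) : Prop :=
  (∀ v, x v ∈ square 0 (k * r)) ∧
  (∀ q ∈ gridCells k,
    (1 - η) * ((N : ℝ) / k ^ 2) ≤ ((Finset.univ.filter fun v => cellOf 0 r (x v) = q).card : ℝ) ∧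
    ((Finset.univ.filter fun v => cellOf 0 r (x v) = q).card : ℝ) ≤ (1 + η) * ((N : ℝ) / k ^ 2)) ∧
  M * ((Finset.univ.filter fun v => x v ∈ borderArea 0 (k * r) W).card : ℝ) ≤ η * N

/-- At a fine resolution, a regular network has a maximum degree of about `M` at most. -/
theorem maxNeighbors_le_of_isRegular {ρ W M r η : ℝ} {k N : ℕ} {x : Fin N → Plane}
    (hρ : 0 ≤ ρ) (hr : 0 < r) (hη : 0 ≤ η) (hM0 : 0 ≤ M)
    (hM : M = Real.pi * (ρ / r) ^ 2 * ((N : ℝ) / k ^ 2))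
    (hhigh : ((diskOffsets (ρ / r + √2)).card : ℝ) ≤ (1 + η) * (Real.pi * (ρ / r) ^ 2))
    (hx : IsRegular W M r η k N x) :
    (maxNeighbors (diskNeighbors ρ x) : ℝ) ≤ (1 + η) ^ 2 * M := by
  classical
  obtain ⟨hsq, hcells, -⟩ := hx
  have hdeg : ∀ v, ((diskNeighbors ρ x v).card : ℝ) ≤ (1 + η) ^ 2 * M := by
    intro v
    set D := (diskOffsets (ρ / r + √2)).image fun u => cellOf 0 r (x v) + u with hD
    have hmaps : ∀ w ∈ diskNeighbors ρ x v, cellOf 0 r (x w) ∈ D := by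
      intro w hw
      have hd : dist (x v) (x w) ≤ ρ := by
        simp only [diskNeighbors, Finset.mem_filter] at hw
        exact hw.2.2
      exact Finset.mem_image.2 ⟨_, cellOf_sub_mem_of_dist_le hr hρ hd, by abel⟩
    have hfib : ∀ q ∈ D, (((diskNeighbors ρ x v).filter fun w => cellOf 0 r (x w) = q).card : ℝ)
        ≤ (1 + η) * ((N : ℝ) / k ^ 2) := by
      intro q _
      by_cases hq : q ∈ gridCells k
      · refine le_trans ?_ (hcells q hq).2
        exact_mod_cast Finset.card_le_card (Finset.filter_subset_filter _ (Finset.subset_univ _))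
      · have hempty : ∀ w, cellOf 0 r (x w) ≠ q := by
          rintro w rfl
          exact hq (cellOf_mem_gridCells hr (by simp) (hsq w))
        simp only [hempty, Finset.filter_false, Finset.card_empty, Nat.cast_zero]
        positivity
    calc ((diskNeighbors ρ x v).card : ℝ)
        = ∑ q ∈ D, (((diskNeighbors ρ x v).filter fun w => cellOf 0 r (x w) = q).card : ℝ) := by
          rw [Finset.card_eq_sum_card_fiberwise (f := fun w => cellOf 0 r (x w)) (t := D) hmaps]
          push_cast
          rfl
      _ ≤ D.card * ((1 + η) * ((N : ℝ) / k ^ 2)) := by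
          rw [← nsmul_eq_mul]
          exact Finset.sum_le_card_nsmul _ _ _ hfib
      _ ≤ ((1 + η) * (Real.pi * (ρ / r) ^ 2)) * ((1 + η) * ((N : ℝ) / k ^ 2)) := by
          refine mul_le_mul_of_nonneg_right (le_trans ?_ hhigh) (by positivity)
          exact_mod_cast Finset.card_image_le
      _ = (1 + η) ^ 2 * M := by rw [hM]; ring
  have hsup : ∀ v ∈ Finset.univ, (diskNeighbors ρ x v).card ≤ ⌊(1 + η) ^ 2 * M⌋₊ :=
    fun v _ => Nat.le_floor (hdeg v)
  exact (Nat.cast_le.2 (Finset.sup_le hsup)).trans (Nat.floor_le (by positivity))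

/-- At a fine resolution, a regular network has a min-cut of about `M` at least. -/
theorem le_minCut_of_isRegular {ρ W M r η : ℝ} {k N : ℕ} {x : Fin N → Plane} (s : Fin N)
    (hr : 0 < r) (hrW : r < W) (hρW : ρ < W) (hη : 0 ≤ η) (hη1 : η < 1) (hM1 : 1 ≤ M)
    (hk : 0 < k) (hN : 2 ≤ N)
    (hM : M = Real.pi * (ρ / r) ^ 2 * ((N : ℝ) / k ^ 2)) (hy : 1 ≤ ρ / r - √2)
    (hlow : (1 - η) * (Real.pi * (ρ / r) ^ 2) ≤ ((diskOffsets (ρ / r - √2)).card : ℝ) - 1)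
    (hx : IsRegular W M r η k N x) :
    (1 - η) ^ 2 * M ≤ minCut (diskNeighbors ρ x)
      (irenIron M (borderArea 0 (k * r) W) x s) s := by
  classical
  obtain ⟨hsq, hcells, -⟩ := hx
  have hη1' : 0 < 1 - η := by linarith
  have hN' : (0 : ℝ) < N := by exact_mod_cast (by omega : 0 < N)
  have hk' : (0 : ℝ) < k := by exact_mod_cast hk
  have hyr : (ρ / r - √2) * r ≤ ρ := by
    rw [sub_mul, div_mul_cancel₀ _ hr.ne', sub_le_self_iff]
    positivity
  refine le_trans (le_min ?_ ?_) (min_le_minCut_of_cells (k := k) (r := r) (y := ρ / r - √2)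
    (n := (1 - η) * ((N : ℝ) / k ^ 2)) (s := s) hr hrW hρW (by simp) hy hyr (by positivity)
    hM1 hsq ?_ ?_ ?_)
  · exact mul_le_of_le_one_left (by linarith) (pow_le_one₀ hη1'.le (by linarith))
  · calc (1 - η) ^ 2 * M
        = ((1 - η) * (Real.pi * (ρ / r) ^ 2)) * ((1 - η) * ((N : ℝ) / k ^ 2)) := by rw [hM]; ring
      _ ≤ _ := mul_le_mul_of_nonneg_right hlow (by positivity)
  · intro q hq
    convert! (hcells q hq).1
  · intro v w h
    exact dist_le_of_cellOf_sub_mem hr (by linarith) h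
  · exact Fintype.exists_ne_of_one_lt_card (by rw [Fintype.card_fin]; omega) s

/-- The ratio that bounds the relative cost of a network which is regular up to the error `η`. -/
noncomputable def regularityRatio (η : ℝ) : ℝ := (1 + η) ^ 2 * (1 + 2 * η) / (1 - η) ^ 2

theorem one_add_two_mul_le_regularityRatio {η : ℝ} (hη : 0 ≤ η) (hη1 : η < 1) :
    1 + 2 * η ≤ regularityRatio η := by
  have : 0 < (1 - η) ^ 2 := pow_pos (by linarith) 2
  rw [regularityRatio, le_div_iff₀ this, mul_comm]
  exact mul_le_mul_of_nonneg_right (by nlinarith) (by linarith)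

theorem isRegular_bounds {ρ W M r η τ : ℝ} {k N : ℕ} {x : Fin N → Plane} (s : Fin N)
    (hρ : 0 ≤ ρ) (hr : 0 < r) (hrW : r < W) (hρW : ρ < W) (hη : 0 ≤ η) (hη1 : η < 1)
    (hM1 : 1 ≤ M) (hk : 0 < k) (hN : 2 ≤ N)
    (hM : M = Real.pi * (ρ / r) ^ 2 * ((N : ℝ) / k ^ 2)) (hy : 1 ≤ ρ / r - √2)
    (hlow : (1 - η) * (Real.pi * (ρ / r) ^ 2) ≤ ((diskOffsets (ρ / r - √2)).card : ℝ) - 1)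
    (hhigh : ((diskOffsets (ρ / r + √2)).card : ℝ) ≤ (1 + η) * (Real.pi * (ρ / r) ^ 2))
    (hMN : M ≤ η * N) (hτ : (N : ℝ) ≤ τ) (hτ' : τ ≤ (1 + 2 * η) * N)
    (hx : IsRegular W M r η k N x) :
    relCost (diskNeighbors ρ x) (irenIron M (borderArea 0 (k * r) W) x s) s ∈
      Set.Icc ((1 - 1 / (N : ℝ)) / regularityRatio η) (regularityRatio η) ∧
    relCostOf τ (diskNeighbors ρ x) (irenIron M (borderArea 0 (k * r) W) x s) s ∈
      Set.Icc ((1 - 1 / (N : ℝ)) / regularityRatio η) (regularityRatio η) ∧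
    innovativeFraction (diskNeighbors ρ x) (irenIron M (borderArea 0 (k * r) W) x s) s ∈
      Set.Icc ((1 - 1 / (N : ℝ)) / regularityRatio η) (regularityRatio η) := by
  classical
  have hdeg := maxNeighbors_le_of_isRegular hρ hr hη (by linarith) hM hhigh hx
  have hcut := le_minCut_of_isRegular s hr hrW hρW hη hη1 hM1 hk hN hM hy hlow hx
  set C := irenIron M (borderArea 0 (k * r) W) x s with hCdef
  set m := minCut (diskNeighbors ρ x) C s with hm
  have hη2 : 0 < (1 - η) ^ 2 := pow_pos (by linarith) 2
  have hcut0 : 0 < m := lt_of_lt_of_le (by positivity) hcut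
  have hC : ∀ v, 0 ≤ C v := irenIron_nonneg (by linarith)
  have hN' : (2 : ℝ) ≤ N := by exact_mod_cast hN
  have hcard : (Fintype.card (Fin N) : ℝ) = N := by rw [Fintype.card_fin]
  have hq1 := one_add_two_mul_le_regularityRatio hη hη1
  have hNN : 0 ≤ 1 - 1 / (N : ℝ) := by
    rw [sub_nonneg, div_le_one (by linarith)]
    linarith
  have hT : transmissionRate C ≤ (1 + 2 * η) * N := by
    have h1 : transmissionRate C ≤ _ := transmissionRate_irenIron_le (by linarith)
    have h2 := hx.2.2
    rw [hcard] at h1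
    linarith
  have hT0 : 0 ≤ transmissionRate C := Finset.sum_nonneg fun v _ => hC v
  have hmain : ∀ t, 0 ≤ t → t ≤ (1 + 2 * η) * N → maxNeighbors (diskNeighbors ρ x) * t ≤
      regularityRatio η * (m * Fintype.card (Fin N)) := by
    intro t ht0 ht
    rw [hcard]
    calc maxNeighbors (diskNeighbors ρ x) * t
        ≤ ((1 + η) ^ 2 * M) * ((1 + 2 * η) * N) := mul_le_mul hdeg ht ht0 (by positivity)
      _ = regularityRatio η * (((1 - η) ^ 2 * M) * N) := by
          rw [regularityRatio, mul_assoc ((1 - η) ^ 2), ← mul_assoc _ ((1 - η) ^ 2),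
            div_mul_cancel₀ _ hη2.ne']
          ring
      _ ≤ regularityRatio η * (m * N) := by
          refine mul_le_mul_of_nonneg_left ?_ (by linarith)
          exact mul_le_mul_of_nonneg_right hcut (by linarith)
  have h1 := relCostOf_mem_Icc hC one_pos hcut0 (one_mul _).ge (hmain _ hT0 hT)
  have h2 := relCostOf_mem_Icc (τ := τ) (γ := 1 + 2 * η) hC (by linarith) hcut0
    (hT.trans (mul_le_mul_of_nonneg_left hτ (by linarith))) (hmain τ (by linarith) hτ')
  have h3 := innovativeFraction_mem_Icc hC (by linarith) hcut0 (by rwa [Fintype.card_fin])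
    (hmain _ hT0 hT)
  rw [hcard] at h1 h2 h3
  refine ⟨⟨le_trans ?_ h1.1, h1.2⟩, ⟨le_trans ?_ h2.1, h2.2⟩, h3.1, h3.2.trans (by linarith)⟩
  · exact div_le_div_of_nonneg_left hNN one_pos (by linarith)
  · exact div_le_div_of_nonneg_left hNN (by linarith) hq1


/-! ### Uniform random locations -/

theorem measurable_coord (i : Fin 2) : Measurable fun p : Plane => p i :=
  (EuclideanSpace.proj (𝕜 := ℝ) i).continuous.measurable

theorem measurableSet_square (c : Plane) (L : ℝ) : MeasurableSet (square c L) := by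
  have : square c L = ⋂ i, {p : Plane | c i ≤ p i} ∩ {p | p i < c i + L} := by
    ext p
    simp [square]
  rw [this]
  exact MeasurableSet.iInter fun i =>
    (measurableSet_le measurable_const (measurable_coord i)).inter
      (measurableSet_lt (measurable_coord i) measurable_const)

theorem measurableSet_borderArea (c : Plane) (L W : ℝ) : MeasurableSet (borderArea c L W) := by
  have : borderArea c L W = square c L ∩
      ⋃ i, ({p : Plane | p i < c i + W} ∪ {p | c i + L - W < p i}) := by
    ext p
    simp [borderArea, -Fin.exists_fin_two]
  rw [this]
  exact (measurableSet_square c L).inter (MeasurableSet.iUnion fun i =>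
    (measurableSet_lt (measurable_coord i) measurable_const).union
      (measurableSet_lt measurable_const (measurable_coord i)))

theorem volume_rectangle {a b a' b' : ℝ} :
    volume {p : Plane | (a ≤ p 0 ∧ p 0 < b) ∧ (a' ≤ p 1 ∧ p 1 < b')} =
      ENNReal.ofReal (b - a) * ENNReal.ofReal (b' - a') := by
  have h : {p : Plane | (a ≤ p 0 ∧ p 0 < b) ∧ (a' ≤ p 1 ∧ p 1 < b')} =
      WithLp.ofLp ⁻¹' (Set.univ.pi fun i => Set.Ico (![a, a'] i) (![b, b'] i)) := by
    ext p
    simp [Set.mem_pi, Fin.forall_fin_two]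
  rw [h, (PiLp.volume_preserving_ofLp (Fin 2)).measure_preimage
    (MeasurableSet.univ_pi fun i => measurableSet_Ico).nullMeasurableSet, Real.volume_pi_Ico]
  simp [Fin.prod_univ_two]

theorem measureReal_rectangle {a b a' b' : ℝ} (h : a ≤ b) (h' : a' ≤ b') :
    volume.real {p : Plane | (a ≤ p 0 ∧ p 0 < b) ∧ (a' ≤ p 1 ∧ p 1 < b')} =
      (b - a) * (b' - a') := by
  rw [measureReal_def, volume_rectangle, ENNReal.toReal_mul,
    ENNReal.toReal_ofReal (by linarith), ENNReal.toReal_ofReal (by linarith)]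

theorem square_eq_rectangle (c : Plane) (L : ℝ) :
    square c L = {p | (c 0 ≤ p 0 ∧ p 0 < c 0 + L) ∧ (c 1 ≤ p 1 ∧ p 1 < c 1 + L)} := by
  ext p
  simp [square, Fin.forall_fin_two]

theorem volume_square (c : Plane) (L : ℝ) :
    volume (square c L) = ENNReal.ofReal L * ENNReal.ofReal L := by
  rw [square_eq_rectangle, volume_rectangle]
  simp

theorem isProbabilityMeasure_cond_square {L : ℝ} (hL : 0 < L) :
    IsProbabilityMeasure (ProbabilityTheory.cond (volume : Measure Plane) (square 0 L)) := by
  refine cond_isProbabilityMeasure_of_finite ?_ ?_ <;> rw [volume_square]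
  · simp [hL]
  · exact ENNReal.mul_ne_top ENNReal.ofReal_ne_top ENNReal.ofReal_ne_top

theorem isProbabilityMeasure_uniformNodes {L : ℝ} (hL : 0 < L) (N : ℕ) :
    IsProbabilityMeasure (uniformNodes N L) := by
  have := isProbabilityMeasure_cond_square hL
  unfold uniformNodes
  infer_instance

theorem measureReal_cond_square {L : ℝ} (hL : 0 < L) {A : Set Plane} (hA : A ⊆ square 0 L) :
    (ProbabilityTheory.cond (volume : Measure Plane) (square 0 L)).real A =
      volume.real A / L ^ 2 := by
  rw [measureReal_def, cond_apply (measurableSet_square 0 L), volume_square,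
    Set.inter_eq_right.2 hA, ENNReal.toReal_mul, ENNReal.toReal_inv, ENNReal.toReal_mul,
    ENNReal.toReal_ofReal hL.le, measureReal_def]
  rw [div_eq_inv_mul, sq]

/-- The cell with index `q` is a square. -/
theorem cellOf_zero_eq_iff {r : ℝ} (hr : 0 < r) (p : Plane) (q : ℤ × ℤ) :
    cellOf 0 r p = q ↔
      (q.1 * r ≤ p 0 ∧ p 0 < q.1 * r + r) ∧ (q.2 * r ≤ p 1 ∧ p 1 < q.2 * r + r) := by
  have h : ∀ (a : ℝ) (i : ℤ), ⌊a / r⌋ = i ↔ i * r ≤ a ∧ a < i * r + r := by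
    intro a i
    rw [Int.floor_eq_iff, le_div_iff₀ hr, div_lt_iff₀ hr, add_mul, one_mul]
  rw [Prod.ext_iff, cellOf]
  simp [h]

theorem measurableSet_cell {r : ℝ} (hr : 0 < r) (q : ℤ × ℤ) :
    MeasurableSet {p : Plane | cellOf 0 r p = q} := by
  simp_rw [cellOf_zero_eq_iff hr]
  have h : ∀ (a b : ℝ) (i : Fin 2), MeasurableSet {p : Plane | a ≤ p i ∧ p i < b} :=
    fun a b i => (measurableSet_le measurable_const (measurable_coord i)).inter
      (measurableSet_lt (measurable_coord i) measurable_const)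
  exact (h _ _ 0).inter (h _ _ 1)

theorem measureReal_cell {r : ℝ} (hr : 0 < r) {k : ℕ} (hk : 0 < k) {q : ℤ × ℤ}
    (hq : q ∈ gridCells k) :
    (ProbabilityTheory.cond (volume : Measure Plane) (square 0 (k * r))).real
      {p : Plane | cellOf 0 r p = q} = 1 / (k : ℝ) ^ 2 := by
  have hk' : (0 : ℝ) < k := by exact_mod_cast hk
  rw [mem_gridCells] at hq
  have hcoord : ∀ (a : ℝ) (i : ℤ), 0 ≤ i → i < (k : ℤ) → i * r ≤ a → a < i * r + r →
      0 ≤ a ∧ a < 0 + k * r := by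
    intro a i h0 h1 h2 h3
    have h0' : (0 : ℝ) ≤ i := by exact_mod_cast h0
    have h1' : (i : ℝ) + 1 ≤ k := by exact_mod_cast h1
    constructor <;> nlinarith
  rw [measureReal_cond_square (by positivity)]
  · simp_rw [cellOf_zero_eq_iff hr]
    rw [measureReal_rectangle (by linarith) (by linarith)]
    field_simp
    ring
  · intro p hp
    obtain ⟨⟨h1, h2⟩, h3, h4⟩ := (cellOf_zero_eq_iff hr p q).1 hp
    rw [square_eq_rectangle]
    exact ⟨hcoord _ _ hq.1.1 hq.1.2 h1 h2, hcoord _ _ hq.2.1 hq.2.2 h3 h4⟩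

theorem measureReal_borderArea_le {L W : ℝ} (hL : 0 < L) (hW : 0 ≤ W) :
    (ProbabilityTheory.cond (volume : Measure Plane) (square 0 L)).real (borderArea 0 L W) ≤
      4 * W / L := by
  rw [measureReal_cond_square hL fun p hp => hp.1]
  set S : Fin 4 → Set Plane :=
    ![{p | (0 ≤ p 0 ∧ p 0 < W) ∧ (0 ≤ p 1 ∧ p 1 < L)},
      {p | (L - W ≤ p 0 ∧ p 0 < L) ∧ (0 ≤ p 1 ∧ p 1 < L)},
      {p | (0 ≤ p 0 ∧ p 0 < L) ∧ (0 ≤ p 1 ∧ p 1 < W)},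
      {p | (0 ≤ p 0 ∧ p 0 < L) ∧ (L - W ≤ p 1 ∧ p 1 < L)}] with hS
  have hvol : ∀ j, volume (S j) = ENNReal.ofReal W * ENNReal.ofReal L := by
    intro j
    fin_cases j
    · exact volume_rectangle.trans (by simp)
    · exact volume_rectangle.trans (by simp)
    · exact volume_rectangle.trans (by simp [mul_comm])
    · exact volume_rectangle.trans (by simp [mul_comm])
  have hsub : borderArea 0 L W ⊆ ⋃ j, S j := by
    rintro p ⟨hp, i, hi⟩
    have h0 := hp 0
    have h1 := hp 1
    simp only [PiLp.zero_apply, zero_add] at h0 h1 hi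
    rw [Set.mem_iUnion]
    fin_cases i
    · rcases hi with hi | hi
      · exact ⟨0, ⟨h0.1, hi⟩, h1⟩
      · exact ⟨1, ⟨le_of_lt hi, h0.2⟩, h1⟩
    · rcases hi with hi | hi
      · exact ⟨2, h0, h1.1, hi⟩
      · exact ⟨3, h0, le_of_lt hi, h1.2⟩
  have hreal : ∀ j, volume.real (S j) = W * L := by
    intro j
    rw [measureReal_def, hvol, ENNReal.toReal_mul, ENNReal.toReal_ofReal hW,
      ENNReal.toReal_ofReal hL.le]
  have hle : volume.real (borderArea 0 L W) ≤ 4 * W * L := by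
    calc volume.real (borderArea 0 L W) ≤ volume.real (⋃ j, S j) := by
          refine measureReal_mono hsub ((measure_iUnion_le S).trans_lt ?_).ne
          simp [hvol, ENNReal.mul_lt_top]
      _ ≤ ∑ j, volume.real (S j) := measureReal_iUnion_fintype_le S
      _ = 4 * W * L := by simp [hreal, mul_assoc]
  rw [div_le_div_iff₀ (by positivity) hL]
  nlinarith

open Classical in
/-- The expected number of hits of `Q` among `N` independent points. -/
theorem integral_card_mem {E : Type*} [MeasurableSpace E] {μ : Measure E} [IsProbabilityMeasure μ]
    {Q : Set E} (hQ : MeasurableSet Q) (N : ℕ) :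
    ∫ x, ((Finset.univ.filter fun v => x v ∈ Q).card : ℝ) ∂(Measure.pi fun _ : Fin N => μ) =
      N * μ.real Q := by
  have h : ∀ x : Fin N → E, ((Finset.univ.filter fun v => x v ∈ Q).card : ℝ)
      = ∑ v, Q.indicator (fun _ => (1 : ℝ)) (x v) := by
    intro x
    simp [Set.indicator_apply]
  have hint : Integrable (Q.indicator fun _ => (1 : ℝ)) μ := (integrable_const 1).indicator hQ
  simp_rw [h]
  rw [integral_finsetSum _ fun v _ => integrable_comp_eval (μ := fun _ : Fin N => μ) (i := v) hint]
  have hv : ∀ v : Fin N, ∫ x, Q.indicator (fun _ => (1 : ℝ)) (x v) ∂(Measure.pi fun _ : Fin N => μ)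
      = μ.real Q := by
    intro v
    rw [integral_comp_eval (μ := fun _ : Fin N => μ) (i := v) hint.aestronglyMeasurable,
      integral_indicator_const _ hQ, smul_eq_mul, mul_one]
  simp [hv]

open Classical in
theorem integrable_card_mem {E : Type*} [MeasurableSpace E] {μ : Measure E}
    [IsProbabilityMeasure μ] {Q : Set E} (hQ : MeasurableSet Q) (N : ℕ) :
    Integrable (fun x => ((Finset.univ.filter fun v => x v ∈ Q).card : ℝ))
      (Measure.pi fun _ : Fin N => μ) := by
  refine Integrable.of_bound (C := N) (measurable_card_filter_mem hQ N).aestronglyMeasurable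
    (ae_of_all _ fun x => ?_)
  rw [Real.norm_eq_abs, Nat.abs_cast]
  exact_mod_cast (Finset.card_le_univ _).trans (Fintype.card_fin N).le

/-! ### Irregular locations are unlikely -/

theorem card_gridCells (k : ℕ) : (gridCells k).card = k ^ 2 := by
  simp [gridCells, sq]

open Classical in
/-- Irregular locations are unlikely: Chernoff's bound applies to each of the `k²` cells, and
Markov's inequality to the number of border nodes. -/
theorem measureReal_not_isRegular_le {W M r η : ℝ} {k N : ℕ} (hW : 0 ≤ W) (hM : 0 ≤ M)
    (hr : 0 < r) (hk : 0 < k) (hN : 0 < N) (hη : 0 < η) (hη1 : η ≤ 1) :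
    (uniformNodes N (k * r)).real {x | ¬ IsRegular W M r η k N x} ≤
      k ^ 2 * (2 * Real.exp (-((N : ℝ) / k ^ 2 * η ^ 2 / 4))) + 4 * W / (k * r) * M / η := by
  have hk' : (0 : ℝ) < k := by exact_mod_cast hk
  have hN' : (0 : ℝ) < N := by exact_mod_cast hN
  have hL : 0 < k * r := by positivity
  have := isProbabilityMeasure_cond_square hL
  have := isProbabilityMeasure_uniformNodes hL N
  set P := uniformNodes N (k * r) with hP
  set A : Set (Fin N → Plane) := {x | ¬ ∀ v, x v ∈ square 0 (k * r)} with hA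
  set D : ℤ × ℤ → Set (Fin N → Plane) := fun q => {x | ¬
    ((1 - η) * ((N : ℝ) / k ^ 2) ≤ ((Finset.univ.filter fun v => cellOf 0 r (x v) = q).card : ℝ) ∧
    ((Finset.univ.filter fun v => cellOf 0 r (x v) = q).card : ℝ) ≤ (1 + η) * ((N : ℝ) / k ^ 2))}
    with hD
  set F : Set (Fin N → Plane) := {x | η * N ≤
    M * ((Finset.univ.filter fun v => x v ∈ borderArea 0 (k * r) W).card : ℝ)} with hF
  have hsub : {x | ¬ IsRegular W M r η k N x} ⊆ A ∪ ((⋃ q ∈ gridCells k, D q) ∪ F) := by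
    intro x hx
    by_contra hcon
    simp only [Set.mem_union, Set.mem_iUnion, not_or, not_exists] at hcon
    obtain ⟨h1, h2, h3⟩ := hcon
    refine hx ⟨not_not.1 h1, fun q hq => ?_, (not_le.1 h3).le⟩
    exact not_not.1 (h2 q hq)
  have hPA : P.real A = 0 := by
    have h : ∀ᵐ x ∂P, ∀ v, x v ∈ square 0 (k * r) := by
      rw [ae_all_iff]
      intro v
      exact Measure.tendsto_eval_ae_ae.eventually (ae_cond_mem (measurableSet_square 0 _))
    rw [measureReal_def, show P A = 0 from h, ENNReal.toReal_zero]
  have hPD : ∀ q ∈ gridCells k, P.real (D q) ≤ 2 * Real.exp (-((N : ℝ) / k ^ 2 * η ^ 2 / 4)) := by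
    intro q hq
    have h := measureReal_card_mem_deviates_le
      (μ := ProbabilityTheory.cond (volume : Measure Plane) (square 0 (k * r)))
      (measurableSet_cell hr q) N (m := (N : ℝ) / k ^ 2)
      (by rw [measureReal_cell hr hk hq, mul_one_div]) hη hη1
    convert! h
  have hPF : P.real F ≤ 4 * W / (k * r) * M / η := by
    have hB := measurableSet_borderArea 0 (k * r) W
    have hmarkov := mul_meas_ge_le_integral_of_nonneg (μ := P)
      (ae_of_all _ fun x => mul_nonneg hM (Nat.cast_nonneg _))
      ((integrable_card_mem hB N).const_mul M) (η * N)
    rw [integral_const_mul, hP, uniformNodes, integral_card_mem hB N] at hmarkov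
    rw [le_div_iff₀ hη]
    refine le_of_mul_le_mul_right ?_ hN'
    calc P.real F * η * N = η * N * P.real F := by ring
      _ ≤ M * (N * (ProbabilityTheory.cond (volume : Measure Plane)
          (square 0 (k * r))).real (borderArea 0 (k * r) W)) := hmarkov
      _ ≤ M * (N * (4 * W / (k * r))) := by
          gcongr
          exact measureReal_borderArea_le hL hW
      _ = 4 * W / (k * r) * M * N := by ring
  calc P.real {x | ¬ IsRegular W M r η k N x}
      ≤ P.real (A ∪ ((⋃ q ∈ gridCells k, D q) ∪ F)) := measureReal_mono hsub
    _ ≤ P.real A + (P.real (⋃ q ∈ gridCells k, D q) + P.real F) :=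
        (measureReal_union_le _ _).trans (add_le_add_right (measureReal_union_le _ _) _)
    _ ≤ 0 + (∑ q ∈ gridCells k, P.real (D q) + P.real F) :=
        add_le_add hPA.le (add_le_add_left (measureReal_biUnion_finset_le _ _) _)
    _ ≤ _ := by
        rw [zero_add]
        refine add_le_add ((Finset.sum_le_card_nsmul _ _ _ hPD).trans_eq ?_) hPF
        rw [card_gridCells, nsmul_eq_mul]
        push_cast
        rfl

/-- The expected number of transmissions: each node makes at least one, and `M` more are made by the
source and each border node. -/
theorem expectedTransmissionRate_mem_Icc {ρ W L : ℝ} {N : ℕ} (hL : 0 < L) (hW : 0 ≤ W)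
    (hM : 1 ≤ diskM ρ N L) {s : (Fin N → Plane) → Fin N} (hs : Measurable s) :
    expectedTransmissionRate ρ W N L s ∈
      Set.Icc (N : ℝ) (N + diskM ρ N L + diskM ρ N L * (N * (4 * W / L))) := by
  classical
  have := isProbabilityMeasure_cond_square hL
  have := isProbabilityMeasure_uniformNodes hL N
  have hB := measurableSet_borderArea 0 L W
  set M := diskM ρ N L with hMdef
  have hcard : (Fintype.card (Fin N) : ℝ) = N := by rw [Fintype.card_fin]
  have hup : ∀ x, transmissionRate (diskRate ρ W N L x (s x)) ≤
      N + M + M * ((Finset.univ.filter fun v => x v ∈ borderArea 0 L W).card : ℝ) := by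
    intro x
    have h : transmissionRate (diskRate ρ W N L x (s x)) ≤ _ :=
      transmissionRate_irenIron_le (by linarith)
    rwa [hcard] at h
  have hlow : ∀ x, (N : ℝ) ≤ transmissionRate (diskRate ρ W N L x (s x)) := by
    intro x
    have h : _ ≤ transmissionRate (diskRate ρ W N L x (s x)) :=
      card_le_transmissionRate_irenIron hM
    rwa [hcard] at h
  have hint : Integrable (fun x =>
      N + M + M * ((Finset.univ.filter fun v => x v ∈ borderArea 0 L W).card : ℝ))
      (uniformNodes N L) :=
    (integrable_const _).add ((integrable_card_mem hB N).const_mul M)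
  have hmeas : Measurable fun x => transmissionRate (diskRate ρ W N L x (s x)) := by
    refine Finset.measurable_fun_sum _ fun v _ => ?_
    have hset : MeasurableSet {x : Fin N → Plane | v = s x ∨ x v ∈ borderArea 0 L W} := by
      have hsv : MeasurableSet {x | v = s x} := by
        simp_rw [eq_comm (a := v)]
        exact hs (measurableSet_singleton v)
      have hBv : MeasurableSet {x : Fin N → Plane | x v ∈ borderArea 0 L W} :=
        measurable_pi_apply v hB
      exact hsv.union hBv
    unfold diskRate irenIron
    exact Measurable.ite hset measurable_const measurable_const
  have hint' : Integrable (fun x => transmissionRate (diskRate ρ W N L x (s x)))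
      (uniformNodes N L) := by
    refine hint.mono hmeas.aestronglyMeasurable (ae_of_all _ fun x => ?_)
    have h0 : (0 : ℝ) ≤ N := Nat.cast_nonneg N
    rw [Real.norm_eq_abs, Real.norm_eq_abs, abs_of_nonneg (h0.trans (hlow x))]
    exact (hup x).trans (le_abs_self _)
  constructor
  · calc (N : ℝ) = ∫ _x, (N : ℝ) ∂(uniformNodes N L) := by simp
      _ ≤ _ := integral_mono (integrable_const _) hint' hlow
  · calc expectedTransmissionRate ρ W N L s
        ≤ ∫ x, (N + M + M * ((Finset.univ.filter fun v => x v ∈ borderArea 0 L W).card : ℝ))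
          ∂(uniformNodes N L) := integral_mono hint' hint hup
      _ = N + M + M * (N * (ProbabilityTheory.cond (volume : Measure Plane)
            (square 0 L)).real (borderArea 0 L W)) := by
          rw [uniformNodes, integral_add (integrable_const _)
            ((integrable_card_mem hB N).const_mul M), integral_const_mul, integral_card_mem hB N]
          simp
      _ ≤ _ := by
          gcongr
          exact measureReal_borderArea_le hL hW

theorem tendsto_rpow_div_atTop {θ : ℝ} (hθ1 : θ < 1) :
    Tendsto (fun L : ℝ => L ^ θ / L) atTop (𝓝 0) := by
  refine (tendsto_rpow_neg_atTop (sub_pos.2 hθ1)).congr' ?_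
  filter_upwards [eventually_gt_atTop 0] with L hL
  rw [neg_sub, Real.rpow_sub_one hL.ne']

/-- The bound of the probability of irregular locations as a function of the edge length `L`, for
`M = L ^ θ` and cells of edge length about `ρ / X`, vanishes as `L → ∞`. -/
theorem tendsto_irregularity_bound {θ : ℝ} (hθ : 0 < θ) (hθ1 : θ < 1) (a b : ℝ) {κ : ℝ}
    (hκ : 0 < κ) :
    Tendsto (fun L : ℝ => a * (L ^ 2 * Real.exp (-κ * L ^ θ)) + b * (L ^ θ / L)) atTop (𝓝 0) := by
  have h1 : Tendsto (fun L : ℝ => L ^ 2 * Real.exp (-κ * L ^ θ)) atTop (𝓝 0) := by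
    refine ((tendsto_rpow_mul_exp_neg_mul_atTop_nhds_zero (2 / θ) κ hκ).comp
      (tendsto_rpow_atTop hθ)).congr' ?_
    filter_upwards [eventually_gt_atTop 0] with L hL
    rw [Function.comp, ← Real.rpow_mul hL.le, mul_div_cancel₀ _ hθ.ne', Real.rpow_two]
  have h2 := tendsto_rpow_div_atTop hθ1
  simpa using (h1.const_mul a).add (h2.const_mul b)

/-! ### The limit of large random networks -/

/-- The bound of `measureReal_not_isRegular_le` in terms of the edge length `L`, for cells of edge
length at least `ρ / (2 Y)`. -/
theorem measureReal_not_isRegular_le_of_le {ρ W L Y r η : ℝ} {k N : ℕ} (hρ : 0 < ρ) (hW : 0 ≤ W)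
    (hL : 0 < L) (hr : 0 < r) (hkr : k * r = L) (hk : 0 < k) (hkY : k ≤ 2 * (L * Y / ρ))
    (hY : 0 < Y) (hN : 0 < N) (hη : 0 < η) (hη1 : η ≤ 1) :
    (uniformNodes N L).real {x | ¬ IsRegular W (diskM ρ N L) r η k N x} ≤
      8 * Y ^ 2 / ρ ^ 2 * (L ^ 2 * Real.exp (-(η ^ 2 / (16 * Real.pi * Y ^ 2)) * diskM ρ N L)) +
        4 * W / η * (diskM ρ N L / L) := by
  have hk' : (0 : ℝ) < k := by exact_mod_cast hk
  have hN' : (0 : ℝ) < N := by exact_mod_cast hN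
  have hM : 0 ≤ diskM ρ N L := by unfold diskM; positivity
  have h := measureReal_not_isRegular_le (N := N) hW hM hr hk hN hη hη1
  rw [hkr] at h
  have hk2 : (k : ℝ) ^ 2 ≤ 4 * Y ^ 2 / ρ ^ 2 * L ^ 2 := by
    calc (k : ℝ) ^ 2 ≤ (2 * (L * Y / ρ)) ^ 2 := pow_le_pow_left₀ hk'.le hkY 2
      _ = 4 * Y ^ 2 / ρ ^ 2 * L ^ 2 := by ring
  refine h.trans (add_le_add ?_ (le_of_eq (by ring)))
  have hexp : -((N : ℝ) / k ^ 2 * η ^ 2 / 4) ≤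
      -(η ^ 2 / (16 * Real.pi * Y ^ 2)) * diskM ρ N L := by
    have hπ := Real.pi_pos
    have h1 : η ^ 2 / (16 * Real.pi * Y ^ 2) * diskM ρ N L =
        (N : ℝ) / (4 * Y ^ 2 / ρ ^ 2 * L ^ 2) * η ^ 2 / 4 := by
      rw [diskM]
      field_simp
      ring
    rw [neg_mul, neg_le_neg_iff, h1]
    gcongr
  calc (k : ℝ) ^ 2 * (2 * Real.exp (-((N : ℝ) / k ^ 2 * η ^ 2 / 4)))
      ≤ (4 * Y ^ 2 / ρ ^ 2 * L ^ 2) *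
          (2 * Real.exp (-(η ^ 2 / (16 * Real.pi * Y ^ 2)) * diskM ρ N L)) := by gcongr
    _ = _ := by ring

theorem exists_regularityRatio_lt {ε : ℝ} (hε : 0 < ε) :
    ∃ η, 0 < η ∧ η < 1 ∧ regularityRatio η < 1 + ε ∧ 1 - ε < 1 / regularityRatio η := by
  have h0 : regularityRatio 0 = 1 := by simp [regularityRatio]
  have hcont : ContinuousAt regularityRatio 0 := by
    unfold regularityRatio
    refine ContinuousAt.div (by fun_prop) (by fun_prop) (by norm_num)
  have hinv : ContinuousAt (fun η => 1 / regularityRatio η) 0 :=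
    continuousAt_const.div hcont (by rw [h0]; exact one_ne_zero)
  have h1 := hcont.eventually_lt_const (u := 1 + ε) (by rw [h0]; linarith)
  have h2 := hinv.eventually_const_lt (u := 1 - ε) (by simp only [h0]; linarith)
  have h3 : ∀ᶠ η : ℝ in 𝓝[>] 0, (regularityRatio η < 1 + ε ∧ 1 - ε < 1 / regularityRatio η) ∧
      η < 1 :=
    ((h1.and h2).and (eventually_lt_nhds one_pos)).filter_mono nhdsWithin_le_nhds
  obtain ⟨η, ⟨⟨ha, hb⟩, hc⟩, hη⟩ := (h3.and self_mem_nhdsWithin).exists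
  exact ⟨η, hη, hc, ha, hb⟩

/-- In a large random network all three quantities are close to `1`, outside a set of locations
whose probability vanishes in the limit. -/
theorem tendsto_measure_not_close {ρ W θ : ℝ} (hρ : 0 < ρ) (hρW : ρ < W) (hθ : 0 < θ) (hθ1 : θ < 1)
    {L : ℕ → ℝ} {N : ℕ → ℕ} (hL : ∀ i, 0 < L i) (hLtop : Tendsto L atTop atTop)
    (hM : ∀ i, diskM ρ (N i) (L i) = L i ^ θ)
    {s : (i : ℕ) → (Fin (N i) → Plane) → Fin (N i)} (hs : ∀ i, Measurable (s i))
    {ε : ℝ} (hε : 0 < ε) :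
    Tendsto (fun i => uniformNodes (N i) (L i) {x | ¬
      (|relCost (diskNeighbors ρ x) (diskRate ρ W (N i) (L i) x (s i x)) (s i x) - 1| < ε ∧
      |relCostOf (expectedTransmissionRate ρ W (N i) (L i) (s i)) (diskNeighbors ρ x)
        (diskRate ρ W (N i) (L i) x (s i x)) (s i x) - 1| < ε ∧
      |innovativeFraction (diskNeighbors ρ x)
        (diskRate ρ W (N i) (L i) x (s i x)) (s i x) - 1| < ε)}) atTop (𝓝 0) := by
  have hW : 0 < W := hρ.trans hρW
  have hπ := Real.pi_pos
  obtain ⟨η, hη, hη1, hq1, hq2⟩ := exists_regularityRatio_lt hε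
  obtain ⟨X, hX⟩ := exists_forall_card_diskOffsets hη √2
  set Y : ℝ := max X 3 with hYdef
  have hY3 : 3 ≤ Y := le_max_right _ _
  have hY : 0 < Y := by linarith
  -- The condition `π ρ² N / L² = L ^ θ` makes the number of nodes grow like `L ^ (2 + θ)`.
  have hN_eq : ∀ i, (N i : ℝ) = L i ^ θ * L i ^ 2 / (Real.pi * ρ ^ 2) := by
    intro i
    have := (hL i).ne'
    rw [← hM i, diskM]
    field_simp
  have hL2 : Tendsto (fun i => L i ^ 2) atTop atTop :=
    (tendsto_pow_atTop two_ne_zero).comp hLtop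
  have hN : Tendsto (fun i => (N i : ℝ)) atTop atTop := by
    simp_rw [hN_eq]
    exact (((tendsto_rpow_atTop hθ).comp hLtop).atTop_mul_atTop₀ hL2).atTop_div_const
      (by positivity)
  have hNq : Tendsto (fun i => (1 - 1 / (N i : ℝ)) / regularityRatio η) atTop
      (𝓝 (1 / regularityRatio η)) := by
    have := ((tendsto_const_nhds (x := (1 : ℝ))).div_atTop hN).const_sub (1 : ℝ)
    rw [sub_zero] at this
    exact this.div_const _
  have hdens : Tendsto (fun i => Real.pi * ρ ^ 2 / L i ^ 2) atTop (𝓝 0) :=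
    tendsto_const_nhds.div_atTop hL2
  have hborder : Tendsto (fun i => 4 * W * (L i ^ θ / L i)) atTop (𝓝 0) := by
    simpa using ((tendsto_rpow_div_atTop hθ1).comp hLtop).const_mul (4 * W)
  set b : ℝ → ℝ := fun l => 8 * Y ^ 2 / ρ ^ 2 *
    (l ^ 2 * Real.exp (-(η ^ 2 / (16 * Real.pi * Y ^ 2)) * l ^ θ)) + 4 * W / η * (l ^ θ / l)
    with hb
  have hb0 : Tendsto (fun i => ENNReal.ofReal (b (L i))) atTop (𝓝 0) := by
    have := (tendsto_irregularity_bound hθ hθ1 (8 * Y ^ 2 / ρ ^ 2) (4 * W / η)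
      (κ := η ^ 2 / (16 * Real.pi * Y ^ 2)) (by positivity)).comp hLtop
    rw [← ENNReal.ofReal_zero]
    exact ENNReal.tendsto_ofReal this
  refine tendsto_of_tendsto_of_tendsto_of_le_of_le' tendsto_const_nhds hb0
    (Eventually.of_forall fun _ => zero_le) ?_
  filter_upwards [hLtop.eventually_ge_atTop (ρ / Y), hLtop.eventually_ge_atTop 1,
    hN.eventually_ge_atTop 2, hNq.eventually_const_lt hq2, hdens.eventually_le_const hη,
    hborder.eventually_le_const hη] with i hLY hL1 hN2 hlow hMN hMb
  have hLi := hL i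
  have := isProbabilityMeasure_uniformNodes hLi (N i)
  have hN2' : 2 ≤ N i := by exact_mod_cast hN2
  have hM1 : 1 ≤ diskM ρ (N i) (L i) := hM i ▸ Real.one_le_rpow hL1 hθ.le
  have hMN' : diskM ρ (N i) (L i) ≤ η * N i := by
    calc diskM ρ (N i) (L i) = Real.pi * ρ ^ 2 / L i ^ 2 * N i := by rw [diskM]; ring
      _ ≤ η * N i := by gcongr
  -- The resolution: cells of edge length `r ≤ ρ / Y` that divide the square exactly.
  set k : ℕ := ⌈L i * Y / ρ⌉₊ with hkdef
  have hLY1 : 1 ≤ L i * Y / ρ := by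
    rw [le_div_iff₀ hρ, one_mul]
    exact (div_le_iff₀ hY).1 hLY
  have hkY : L i * Y / ρ ≤ k := Nat.le_ceil _
  have hk2Y : (k : ℝ) ≤ 2 * (L i * Y / ρ) := by
    have := Nat.ceil_lt_add_one (by linarith : 0 ≤ L i * Y / ρ)
    linarith
  have hk' : (0 : ℝ) < k := by linarith
  have hk : 0 < k := by exact_mod_cast hk'
  set r : ℝ := L i / k with hrdef
  have hr : 0 < r := by positivity
  have hkr : k * r = L i := mul_div_cancel₀ _ hk'.ne'
  have hYr : Y ≤ ρ / r := by
    rw [le_div_iff₀ hr, hrdef, mul_div_assoc', div_le_iff₀ hk', mul_comm Y]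
    rw [div_le_iff₀ hρ] at hkY
    linarith
  have hrW : r < W := by
    have h3 : 3 * r ≤ ρ := (le_div_iff₀ hr).1 (hY3.trans hYr)
    linarith
  have hMr : diskM ρ (N i) (L i) = Real.pi * (ρ / r) ^ 2 * ((N i : ℝ) / k ^ 2) := by
    rw [diskM, ← hkr]
    field_simp
  have hy : 1 ≤ ρ / r - √2 := by
    have : √2 ≤ 2 := Real.sqrt_le_iff.2 ⟨by norm_num, by norm_num⟩
    linarith
  obtain ⟨hcard1, hcard2⟩ := hX (ρ / r) ((le_max_left _ _).trans hYr)
  have hτ := expectedTransmissionRate_mem_Icc hLi hW.le hM1 (hs i)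
  have hτ' : expectedTransmissionRate ρ W (N i) (L i) (s i) ≤ (1 + 2 * η) * N i := by
    have h1 : diskM ρ (N i) (L i) * (N i * (4 * W / L i)) ≤ η * N i := by
      calc diskM ρ (N i) (L i) * (N i * (4 * W / L i))
          = 4 * W * (L i ^ θ / L i) * N i := by
            rw [hM i]; ring
        _ ≤ η * N i := by gcongr
    linarith [hτ.2]
  have hprob : uniformNodes (N i) (L i)
      {x | ¬ IsRegular W (diskM ρ (N i) (L i)) r η k (N i) x} ≤ ENNReal.ofReal (b (L i)) := by
    rw [← ofReal_measureReal]
    refine ENNReal.ofReal_le_ofReal ?_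
    have h := measureReal_not_isRegular_le_of_le (N := N i) hρ hW.le hLi hr hkr hk hk2Y hY
      (by omega) hη hη1.le
    rw [hM i] at h ⊢
    exact h
  refine le_trans (measure_mono ?_) hprob
  intro x hx hreg
  refine hx ?_
  have h := isRegular_bounds (τ := expectedTransmissionRate ρ W (N i) (L i) (s i)) (s i x)
    hρ.le hr hrW hρW hη.le hη1 hM1 hk hN2' hMr hy hcard1 hcard2 hMN' hτ.1 hτ' hreg
  rw [hkr] at h
  have hclose : ∀ a ∈ Set.Icc ((1 - 1 / (N i : ℝ)) / regularityRatio η) (regularityRatio η),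
      |a - 1| < ε := by
    intro a ha
    rw [abs_lt]
    constructor <;> linarith [ha.1, ha.2]
  exact ⟨hclose _ h.1, hclose _ h.2.1, hclose _ h.2.2⟩

end NearOptimalBroadcast

open NearOptimalBroadcast in
theorem mainTheorem3 :
    -- lattice networks: relative cost `1 + O(1/L)`, uniformly in the source and in the position
    (∀ ρ W : ℝ, 1 ≤ ρ → ρ < W →
      ∃ K : ℝ, ∃ L₀ : ℕ, ∀ L : ℕ, L₀ ≤ L → ∀ (c : Plane) (s : LatticeNode c L),
        |relCost (latticeH ρ c L) (latticeRate ρ W c L s) s - 1| ≤ K / L ∧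
        |innovativeFraction (latticeH ρ c L) (latticeRate ρ W c L s) s - 1| ≤ K / L) ∧
    -- random unit disk graphs with `M = L ^ θ`
    (∀ ρ W θ : ℝ, 0 < ρ → ρ < W → 0 < θ → θ < 1 →
      ∀ (L : ℕ → ℝ) (N : ℕ → ℕ), (∀ i, 0 < L i) → Filter.Tendsto L Filter.atTop Filter.atTop →
        (∀ i, diskM ρ (N i) (L i) = L i ^ θ) →
        ∀ s : (i : ℕ) → (Fin (N i) → Plane) → Fin (N i), (∀ i, Measurable (s i)) →
          TendstoInProb (fun i => uniformNodes (N i) (L i))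
            (fun i x => relCost (diskNeighbors ρ x)
              (diskRate ρ W (N i) (L i) x (s i x)) (s i x)) 1 ∧
          TendstoInProb (fun i => uniformNodes (N i) (L i))
            (fun i x => relCostOf (expectedTransmissionRate ρ W (N i) (L i) (s i))
              (diskNeighbors ρ x) (diskRate ρ W (N i) (L i) x (s i x)) (s i x)) 1 ∧
          TendstoInProb (fun i => uniformNodes (N i) (L i))
            (fun i x => innovativeFraction (diskNeighbors ρ x)
              (diskRate ρ W (N i) (L i) x (s i x)) (s i x)) 1) := by
  refine ⟨fun ρ W hρ hW => lattice_asymptotics hρ hW,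
    fun ρ W θ hρ hW hθ hθ1 L N hL hLtop hM s hs => ⟨?_, ?_, ?_⟩⟩ <;>
  · intro ε hε
    refine tendsto_of_tendsto_of_tendsto_of_le_of_le tendsto_const_nhds
      (tendsto_measure_not_close hρ hW hθ hθ1 hL hLtop hM hs hε) (fun _ => zero_le)
      fun i => measure_mono fun x hx hclose => ?_
    first
    | exact not_lt.2 hx hclose.1
    | exact not_lt.2 hx hclose.2.1
    | exact not_lt.2 hx hclose.2.2
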